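/- Let $T\in[0,\infty)$, let $(\Omega,\mathcal F,(\mathcal F_t)_{t\in[0,T]},P)$ be a filtered probability space satisfying the usual assumptions, and let $S$ be an $\mathbb R^d$-valued semimartingale on it with $\sup_{t\le T}|S_t|\in L^1(P)$. Let $\mathcal K\subseteq L^1(P)$ be the linear space of terminal gains $K=\sum_{i=1}^{n-1}H_i\cdot(S_{\tau_{i+1}}-S_{\tau_i})$, where $0\le\tau_1\le\dots\le\tau_n\le T$ are stopping times and each $H_i$ is a bounded, $\mathcal F_{\tau_i}$-measurable, $\mathbb R^d$-valued random variable. Assume that the market is non-trivial, i.e. that $\mathcal K$ contains some $K$ which is not $P$-a.s. zero. For a non-null $X\in L^1(P)$ let $\alpha(X)=E[X^+]/E[X^-]\in[0,+\infty]$ (with $c/0=+\infty$ for $c>0$), and for $B\in L^1(P)$ let $$\alpha^*(B)=\sup_{K\in\mathcal K,\;B+K\neq0}\alpha(B+K)\in[0,+\infty].$$ For $\lambda\in[1,\infty)$ let $U_\lambda(x)=x^+-\lambda x^-$ and $V_\lambda(y)=\sup_{x\in\mathbb R}(U_\lambda(x)-xy)$; let $\mathcal Q_\lambda$ be the set of probabilities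 $Q\ll P$ such that $E[V_\lambda(y\,\frac{dQ}{dP})]<+\infty$ for some $y>0$; and let $\mathcal M$ be the set of probabilities $Q\ll P$ under which $S$ is a martingale. Let $\rho^M_\lambda(X)=\sup_{Q\in\mathcal Q_\lambda\cap\mathcal M}E_Q[-X]$, with $\rho^M_\lambda=-\infty$ if $\mathcal Q_\lambda\cap\mathcal M=\emptyset$. Then, for every $B\in L^1(P)$ and with the convention $\sup\emptyset=\alpha^*(0)$, $$\alpha^*(B)=\sup\{\lambda\ge1 : E_Q[B]>0\ \ \forall Q\in\mathcal Q_\lambda\cap\mathcal M\},$$ and, in terms of the market-modified risk measures $\rho^M_\lambda$ induced by $\mathcal Q_\lambda\cap\mathcal M$, $$\alpha^*(B)=\sup\{\lambda\ge1 : \rho^M_\lambda(B)<0\}.$$ -/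

import Mathlib

open MeasureTheory ProbabilityTheory Filter Topology
open scoped ENNReal NNReal

noncomputable section

namespace GainLoss

/-- The time interval `[0, T]`. -/
abbrev Time (T : ℝ≥0) : Type := Set.Iic T

variable {Ω : Type*} {m : MeasurableSpace Ω} {T : ℝ≥0} {d : ℕ}

/-! ### The stochastic basis and semimartingales -/

/-- The usual assumptions on a filtration: it is right continuous, and the initial σ-algebra
contains every subset of a `P`-null set (in particular `P` is complete). -/
structure UsualAssumptions (F : Filtration (Time T) m) (P : Measure Ω) : Prop where
  rightCont : F.IsRightContinuous
  null : ∀ A : Set Ω, P A = 0 → MeasurableSet[F ⊥] A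

/-- A path is càdlàg: right continuous with left limits (no condition on the left at time `0`,
where the left neighbourhood filter is trivial). -/
def IsCadlag {E : Type*} [TopologicalSpace E] (f : Time T → E) : Prop :=
  ∀ t, ContinuousWithinAt f (Set.Ici t) t ∧ ∃ l, Tendsto f (𝓝[<] t) (𝓝 l)

/-- A local martingale: a process which is locally (along stopping times that almost surely
increase to `⊤`, that is, are eventually beyond the horizon) a càdlàg martingale. -/
def IsLocalMartingale (M : Time T → Ω → EuclideanSpace ℝ (Fin d))
    (F : Filtration (Time T) m) (P : Measure Ω) : Prop :=
  Locally (fun N => Martingale N F P ∧ ∀ᵐ ω ∂P, IsCadlag (fun t => N t ω)) F M P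

/-- An adapted càdlàg process whose paths have finite variation on `[0, T]`. -/
structure IsFiniteVariation (A : Time T → Ω → EuclideanSpace ℝ (Fin d))
    (F : Filtration (Time T) m) (P : Measure Ω) : Prop where
  adapted : StronglyAdapted F A
  cadlag : ∀ᵐ ω ∂P, IsCadlag (fun t => A t ω)
  variation : ∀ᵐ ω ∂P, BoundedVariationOn (fun t => A t ω) Set.univ

/-- A semimartingale: an adapted càdlàg process which is the sum of a local martingale and of an
adapted càdlàg process of finite variation. -/
structure IsSemimartingale (S : Time T → Ω → EuclideanSpace ℝ (Fin d))
    (F : Filtration (Time T) m) (P : Measure Ω) : Prop where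
  adapted : StronglyAdapted F S
  cadlag : ∀ᵐ ω ∂P, IsCadlag (fun t => S t ω)
  decomposition : ∃ M A : Time T → Ω → EuclideanSpace ℝ (Fin d),
    IsLocalMartingale M F P ∧ IsFiniteVariation A F P ∧
      ∀ᵐ ω ∂P, ∀ t, S t ω = M t ω + A t ω

/-- The maximal functional `S*_T = sup_{t ≤ T} |S_t|`, with values in `[0, ∞]`. -/
def maximalFunctional (S : Time T → Ω → EuclideanSpace ℝ (Fin d)) (ω : Ω) : ℝ≥0∞ :=
  ⨆ t : Time T, ‖S t ω‖ₑ

/-! ### Admissible strategies and gains -/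

/-- A simple, predictable and bounded strategy `∑ i, H i · 1_{]τ i, τ (i+1)]}`: the `τ i` are
ordered stopping times with values in `[0, T]`, and `H i` is bounded and `F_{τ i}`-measurable. -/
structure Strategy (F : Filtration (Time T) m) (d : ℕ) where
  n : ℕ
  τ : Fin (n + 1) → Ω → Time T
  isStoppingTime : ∀ i, IsStoppingTime F (fun ω => ((τ i ω : Time T) : WithTop (Time T)))
  monotone : ∀ ω, Monotone (fun i => τ i ω)
  H : Fin n → Ω → EuclideanSpace ℝ (Fin d)
  measurable_H : ∀ i : Fin n,
    Measurable[(isStoppingTime i.castSucc).measurableSpace] (H i)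
  bounded_H : ∃ C : ℝ, ∀ i ω, ‖H i ω‖ ≤ C

/-- The terminal gain `∑ i, H i · (S_{τ (i+1)} - S_{τ i})` of a simple strategy. -/
def Strategy.gain {F : Filtration (Time T) m} (ξ : Strategy F d)
    (S : Time T → Ω → EuclideanSpace ℝ (Fin d)) (ω : Ω) : ℝ :=
  ∑ i : Fin ξ.n, inner ℝ (ξ.H i ω) (S (ξ.τ i.succ ω) ω - S (ξ.τ i.castSucc ω) ω)

/-- The set `𝒦` of terminal admissible gains. -/
def gains (S : Time T → Ω → EuclideanSpace ℝ (Fin d)) (F : Filtration (Time T) m) :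
    Set (Ω → ℝ) :=
  {K | ∃ ξ : Strategy F d, K = ξ.gain S}

/-! ### The gain-loss ratio -/

/-- The gain-loss ratio `E[X⁺] / E[X⁻]` in `[0, ∞]`, with `c / 0 = ∞` for `c > 0`. -/
def gainLossRatio (P : Measure Ω) (X : Ω → ℝ) : ℝ≥0∞ :=
  (∫⁻ ω, ENNReal.ofReal (X ω) ∂P) / ∫⁻ ω, ENNReal.ofReal (-X ω) ∂P

/-- The best gain-loss ratio `α*(B)`: the supremum of `α(B + K)` over the gains `K` for which
`B + K` is not the null payoff. -/
def bestGainLoss (S : Time T → Ω → EuclideanSpace ℝ (Fin d)) (F : Filtration (Time T) m)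
    (P : Measure Ω) (B : Ω → ℝ) : ℝ≥0∞ :=
  ⨆ K ∈ gains S F, ⨆ _ : ¬ (B + K =ᵐ[P] 0), gainLossRatio P (B + K)

/-! ### Dual objects -/

/-- The piecewise linear utility `U_l(x) = x⁺ - l x⁻`. -/
def utility (l x : ℝ) : ℝ := x⁺ - l * x⁻

/-- The convex conjugate `V_l(y) = sup_x (U_l(x) - x y)`. -/
def conjugate (l y : ℝ) : EReal := ⨆ x : ℝ, ((utility l x - x * y : ℝ) : EReal)

/-- The set `𝒬_l` of probabilities `Q ≪ P` with finite `V_l`-entropy: `E[V_l(y dQ/dP)] < ∞` for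
some `y > 0`. (`V_l` is nonnegative, as one sees by taking `x = 0`.) -/
def finiteEntropy (P : Measure Ω) (l : ℝ) : Set (Measure Ω) :=
  {Q | IsProbabilityMeasure Q ∧ Q ≪ P ∧
    ∃ y : ℝ, 0 < y ∧ ∫⁻ ω, (conjugate l (y * (Q.rnDeriv P ω).toReal)).toENNReal ∂P < ⊤}

/-- The set `ℳ` of martingale measures: probabilities `Q ≪ P` under which `S` is a martingale. -/
def martingaleMeasures (S : Time T → Ω → EuclideanSpace ℝ (Fin d))
    (F : Filtration (Time T) m) (P : Measure Ω) : Set (Measure Ω) :=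
  {Q | IsProbabilityMeasure Q ∧ Q ≪ P ∧ Martingale S F Q}

/-- The market modified risk measure `ρ_l(X) = sup {E_Q[-X] | Q ∈ 𝒬_l ∩ ℳ}`, which is `-∞` if
`𝒬_l ∩ ℳ` is empty. -/
def marketRisk (S : Time T → Ω → EuclideanSpace ℝ (Fin d)) (F : Filtration (Time T) m)
    (P : Measure Ω) (l : ℝ) (X : Ω → ℝ) : EReal :=
  ⨆ Q ∈ finiteEntropy P l ∩ martingaleMeasures S F P, ((∫ ω, -X ω ∂Q : ℝ) : EReal)

open Classical in
/-- The supremum in `[0, ∞]` of a set of nonnegative real numbers, with the convention that the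
supremum of the empty set is `a`. -/
def supWithDefault (a : ℝ≥0∞) (s : Set ℝ) : ℝ≥0∞ :=
  if s = ∅ then a else ⨆ l ∈ s, ENNReal.ofReal l

end GainLoss

end

namespace GainLoss

/-! ### The piecewise linear utility -/

/-! The ratio `α(X)` exceeds `λ` exactly when `E[U_λ(X)] = E[X⁺] - λ E[X⁻] > 0`, so `α*(B) > λ`
means that some `B + K` has positive expected utility. The core is the equivalence, for each `λ ≥
1`, of this with `E_Q[B] > 0` for all `Q ∈ 𝒬_λ ∩ ℳ` (`forall_integral_pos_iff`). Since `V_λ` is `0`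
on `[1, λ]` and `∞` elsewhere, `Q ∈ 𝒬_λ` says that `y dQ/dP` takes values in `[1, λ]` for some `y >
0`.

Easy direction: `U_λ(x) ≤ z x` for every slope `z ∈ [1, λ]`, so `E[U_λ(B + K)] ≤ y E_Q[B + K] = y
E_Q[B]`, because martingale measures annihilate gains. As `y ≤ λ`, this bounds `E_Q[B]` below
uniformly in `Q`, whence also `ρ_λ(B) < 0`.

Hard direction: if no `B + K` has positive expected utility, the sublinear functional `-E[U_λ]` is
nonnegative on the cone `{tB + K : t ≥ 0}`. Hahn-Banach yields a linear functional between the two,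
represented by a density in `[1, λ]` (`exists_density_of_expectedUtility_add_nonpos`). Normalized,
it is a measure in `𝒬_λ` that annihilates `𝒦`, hence lies in `ℳ`, and has `E_Q[B] ≤ 0`.

So both sets of `λ` equal `[1, α*(B))`. If this is empty then `α*(B) ≤ 1`, while `1 ≤ α*(0) ≤
α*(B)`: non-triviality and `K ↦ -K` give the first inequality, scaling `K` up the second. This is
the convention for `sup ∅`. -/

theorem utility_of_nonneg (l : ℝ) {x : ℝ} (hx : 0 ≤ x) : utility l x = x := by
  simp [utility, posPart_of_nonneg hx, negPart_of_nonneg hx]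

theorem utility_of_nonpos (l : ℝ) {x : ℝ} (hx : x ≤ 0) : utility l x = l * x := by
  simp [utility, posPart_of_nonpos hx, negPart_of_nonpos hx]

theorem utility_mul (l : ℝ) {c : ℝ} (hc : 0 ≤ c) (x : ℝ) : utility l (c * x) = c * utility l x := by
  rcases le_total 0 x with hx | hx
  · rw [utility_of_nonneg l hx, utility_of_nonneg l (mul_nonneg hc hx)]
  · rw [utility_of_nonpos l hx, utility_of_nonpos l (mul_nonpos_of_nonneg_of_nonpos hc hx)]
    ring

/-- For `l ≥ 1`, `U_l` is the minimum of the lines of slope `1` and `l`, and any intermediate slope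
lies above that minimum. This links utility to densities with values in `[1, l]`. -/
theorem utility_le_mul {l z : ℝ} (h1 : 1 ≤ z) (hl : z ≤ l) (x : ℝ) : utility l x ≤ z * x := by
  rcases le_total 0 x with hx | hx
  · rw [utility_of_nonneg l hx]
    nlinarith
  · rw [utility_of_nonpos l hx]
    nlinarith

theorem utility_add_le {l : ℝ} (hl : 1 ≤ l) (x y : ℝ) :
    utility l x + utility l y ≤ utility l (x + y) := by
  rcases le_total 0 (x + y) with h | h
  · rw [utility_of_nonneg l h]
    linarith [utility_le_mul le_rfl hl x, utility_le_mul le_rfl hl y]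
  · rw [utility_of_nonpos l h]
    linarith [utility_le_mul hl le_rfl x, utility_le_mul hl le_rfl y]

/-- `U_l` is Lipschitz; the crude constant `1 + l` serves for all `l ≥ 0`, including `l < 1`. -/
theorem sub_le_utility_add {l : ℝ} (hl : 0 ≤ l) (x y : ℝ) :
    utility l x - (1 + l) * |y| ≤ utility l (x + y) := by
  have hy := abs_nonneg y
  have hy1 := neg_abs_le y
  have hy2 := le_abs_self y
  rcases le_total 0 x with hx | hx <;> rcases le_total 0 (x + y) with h | h
  · rw [utility_of_nonneg l hx, utility_of_nonneg l h]
    nlinarith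
  · rw [utility_of_nonneg l hx, utility_of_nonpos l h]
    nlinarith
  · rw [utility_of_nonpos l hx, utility_of_nonneg l h]
    nlinarith
  · rw [utility_of_nonpos l hx, utility_of_nonpos l h]
    nlinarith

theorem continuous_utility (l : ℝ) : Continuous (utility l) := by
  unfold utility
  fun_prop

theorem abs_utility_le {l : ℝ} (hl : 0 ≤ l) (x : ℝ) : |utility l x| ≤ (1 + l) * |x| := by
  rcases le_total 0 x with hx | hx
  · rw [utility_of_nonneg l hx]
    nlinarith [abs_nonneg x]
  · rw [utility_of_nonpos l hx, abs_mul, abs_of_nonneg hl]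
    nlinarith [abs_nonneg x]

/-- The expected utility `E[U_l(X)]`. -/
noncomputable def expectedUtility {Ω : Type*} {m : MeasurableSpace Ω} (P : Measure Ω) (l : ℝ)
    (X : Ω → ℝ) : ℝ :=
  ∫ ω, utility l (X ω) ∂P

/-! ### Expected utility as a superlinear functional on integrable claims -/

section ExpectedUtility

variable {Ω : Type*} {m : MeasurableSpace Ω} {P : Measure Ω} {l : ℝ} {X Y : Ω → ℝ}

theorem integrable_utility (hl : 0 ≤ l) (hX : Integrable X P) :
    Integrable (fun ω => utility l (X ω)) P := by
  refine Integrable.mono' (hX.abs.const_mul (1 + l))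
    ((continuous_utility l).comp_aestronglyMeasurable hX.aestronglyMeasurable) ?_
  exact ae_of_all _ fun ω => abs_utility_le hl _

theorem expectedUtility_congr (h : X =ᵐ[P] Y) : expectedUtility P l X = expectedUtility P l Y :=
  integral_congr_ae (h.mono fun ω hω => by simp only [hω])

theorem expectedUtility_const_mul {c : ℝ} (hc : 0 ≤ c) :
    expectedUtility P l (fun ω => c * X ω) = c * expectedUtility P l X := by
  simp only [expectedUtility, utility_mul l hc, integral_const_mul]

theorem expectedUtility_add_le (hl : 1 ≤ l) (hX : Integrable X P) (hY : Integrable Y P) :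
    expectedUtility P l X + expectedUtility P l Y ≤ expectedUtility P l (fun ω => X ω + Y ω) := by
  have hl0 : 0 ≤ l := by linarith
  unfold expectedUtility
  rw [← integral_add (integrable_utility hl0 hX) (integrable_utility hl0 hY)]
  exact integral_mono ((integrable_utility hl0 hX).add (integrable_utility hl0 hY))
    (integrable_utility hl0 (hX.add hY)) fun ω => utility_add_le hl _ _

theorem sub_le_expectedUtility_add (hl : 0 ≤ l) (hX : Integrable X P) (hY : Integrable Y P) :
    expectedUtility P l X - (1 + l) * ∫ ω, |Y ω| ∂P ≤
      expectedUtility P l (fun ω => X ω + Y ω) := by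
  unfold expectedUtility
  rw [← integral_const_mul, ← integral_sub (integrable_utility hl hX) (hY.abs.const_mul _)]
  exact integral_mono ((integrable_utility hl hX).sub (hY.abs.const_mul _))
    (integrable_utility hl (hX.add hY)) fun ω => sub_le_utility_add hl _ _

theorem expectedUtility_le_integral_mul {Z : Ω → ℝ} (hl : 0 ≤ l) (hX : Integrable X P)
    (hZX : Integrable (fun ω => Z ω * X ω) P) (hZ : ∀ᵐ ω ∂P, 1 ≤ Z ω ∧ Z ω ≤ l) :
    expectedUtility P l X ≤ ∫ ω, Z ω * X ω ∂P :=
  integral_mono_ae (integrable_utility hl hX) hZX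
    (hZ.mono fun _ hω => utility_le_mul hω.1 hω.2 _)

/-- Adding a large multiple of a claim with positive expected utility yields a positive expected
utility. -/
theorem exists_expectedUtility_add_mul_pos (hl : 0 ≤ l) (hX : Integrable X P)
    (hY : Integrable Y P) (h : 0 < expectedUtility P l X) :
    ∃ t : ℝ, 0 < t ∧ 0 < expectedUtility P l (fun ω => Y ω + t * X ω) := by
  set a := expectedUtility P l X
  set b := (1 + l) * ∫ ω, |Y ω| ∂P with hb_def
  have hb : 0 ≤ b := mul_nonneg (by linarith) (integral_nonneg fun ω => abs_nonneg _)
  -- With this factor the scaled claim has expected utility `b + 1`, and adding `Y` costs at most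
  -- `b`.
  refine ⟨(b + 1) / a, by positivity, ?_⟩
  have h1 := sub_le_expectedUtility_add (l := l) hl (hX.const_mul ((b + 1) / a)) hY
  rw [expectedUtility_const_mul (by positivity), div_mul_cancel₀ _ h.ne', ← hb_def] at h1
  simp only [add_comm (Y _)]
  linarith

end ExpectedUtility

/-! ### Duality -/

/-- A sublinear functional which is nonnegative on a convex cone dominates a linear functional which
is nonnegative on the cone. -/
theorem exists_linear_le_sublinear_of_nonneg_on_cone {E : Type*} [AddCommGroup E] [Module ℝ E]
    (q : E → ℝ) (C : PointedCone ℝ E) (q_zero : q 0 = 0)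
    (q_hom : ∀ c : ℝ, 0 < c → ∀ x, q (c • x) = c * q x)
    (q_add : ∀ x y, q (x + y) ≤ q x + q y) (hC : ∀ x ∈ C, 0 ≤ q x) :
    ∃ f : E →ₗ[ℝ] ℝ, (∀ x, f x ≤ q x) ∧ ∀ x ∈ C, 0 ≤ f x := by
  -- Essentially the epigraph of `x ↦ inf_{c ∈ C} q (x + c)`. The coordinate `(0, r) ↦ r` is
  -- nonnegative on it because `q ≥ 0` on `C`. A positive extension `g` gives `f x = -g (x, 0)`: the
  -- point `(x, q x)` yields `f ≤ q`, the point `(-x, 0)` with `c = x` yields `f ≥ 0` on `C`.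
  let s : PointedCone ℝ (E × ℝ) :=
    { carrier := {p | ∃ c ∈ C, q (p.1 + c) ≤ p.2}
      zero_mem' := ⟨0, C.zero_mem, by simp [q_zero]⟩
      smul_mem' := by
        rintro ⟨a, ha⟩ p ⟨c, hc, hp⟩
        rcases eq_or_lt_of_le ha with h0 | h0
        · refine ⟨0, C.zero_mem, ?_⟩
          simp [← h0, q_zero]
        · refine ⟨a • c, C.smul_mem ha hc, ?_⟩
          change q (a • p.1 + a • c) ≤ a * p.2
          rw [← smul_add, q_hom a h0]
          exact mul_le_mul_of_nonneg_left hp ha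
      add_mem' := by
        rintro p p' ⟨c, hc, hp⟩ ⟨c', hc', hp'⟩
        refine ⟨c + c', C.add_mem hc hc', ?_⟩
        have := q_add (p.1 + c) (p'.1 + c')
        rw [add_add_add_comm] at this
        exact this.trans (add_le_add hp hp') }
  let f0 : (E × ℝ) →ₗ.[ℝ] ℝ := (LinearMap.snd ℝ E ℝ).toPMap (Submodule.prod ⊥ ⊤)
  obtain ⟨g, hg, hgs⟩ := riesz_extension s f0
    (by
      rintro ⟨⟨x, r⟩, hx⟩ ⟨c, hc, hp⟩
      have hx0 : x = 0 := hx.1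
      subst hx0
      have := hC c hc
      simp only [zero_add] at hp
      exact this.trans hp)
    (by
      rintro ⟨x, r⟩
      refine ⟨⟨(0, q x - r), by simp, by simp⟩, 0, C.zero_mem, ?_⟩
      simp)
  have hg2 : ∀ r : ℝ, g (0, r) = r := fun r => hg ⟨(0, r), by simp, by simp⟩
  refine ⟨-(g ∘ₗ LinearMap.inl ℝ E ℝ), fun x => ?_, fun x hx => ?_⟩
  · have h := hgs (x, q x) ⟨0, C.zero_mem, by simp⟩
    have h2 : g (x, q x) = g (x, 0) + g (0, q x) := by rw [← map_add]; simp
    rw [h2, hg2] at h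
    simp only [LinearMap.neg_apply, LinearMap.comp_apply, LinearMap.inl_apply]
    linarith
  · have h := hgs (-x, 0) ⟨x, hx, by simp [q_zero]⟩
    have h2 : g (-x, 0) = - g (x, 0) := by rw [← map_neg]; simp
    rw [h2] at h
    simpa using h

/-- A linear functional on `L¹` which lies between `X ↦ E[U_l(X)]` and `X ↦ -E[U_l(-X)]` is the
integral against a density with values in `[1, l]`. -/
theorem exists_density_of_expectedUtility_le {Ω : Type*} {m : MeasurableSpace Ω} {P : Measure Ω}
    [IsProbabilityMeasure P] {l : ℝ} (hl : 1 ≤ l) (g : Lp ℝ 1 P →ₗ[ℝ] ℝ)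
    (hg : ∀ X : Lp ℝ 1 P, expectedUtility P l X ≤ g X) :
    ∃ Z : Ω → ℝ, Measurable Z ∧ (∀ ω, 1 ≤ Z ω ∧ Z ω ≤ l) ∧
      ∀ (X : Ω → ℝ) (hX : Integrable X P), g (hX.toL1 X) = ∫ ω, Z ω * X ω ∂P := by
  have hl0 : 0 ≤ l := by linarith
  have hupper : ∀ X, g X ≤ l * ‖X‖ := by
    intro X
    have h1 := hg (-X)
    rw [map_neg, expectedUtility_congr (Lp.coeFn_neg X)] at h1
    have hX := L1.integrable_coeFn X
    have h2 : -(l * ‖X‖) ≤ expectedUtility P l (-⇑X) := by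
      rw [L1.norm_eq_integral_norm, ← integral_const_mul, ← integral_neg]
      refine integral_mono (hX.norm.const_mul l).neg (integrable_utility hl0 hX.neg) fun ω => ?_
      simp only [Pi.neg_apply, Real.norm_eq_abs]
      rcases le_total 0 (-X ω) with h | h
      · rw [utility_of_nonneg l h]
        nlinarith [abs_nonneg (X ω)]
      · rw [utility_of_nonpos l h]
        nlinarith [le_abs_self (X ω)]
    linarith
  have hbound : ∀ X, ‖g X‖ ≤ l * ‖X‖ := by
    intro X
    rw [Real.norm_eq_abs, abs_le]
    have := hupper (-X)
    rw [map_neg, norm_neg] at this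
    exact ⟨by linarith, hupper X⟩
  let G : Lp ℝ 1 P →L[ℝ] ℝ := g.mkContinuous l hbound
  have hGg : ∀ X, G X = g X := fun X => rfl
  -- Restricting `g` to `L²` lets the Hilbert space representation theorem supply the density `z`.
  let ι : Lp ℝ 2 P →ₗ[ℝ] Lp ℝ 1 P :=
    { toFun := fun x => ⟨x.1, Lp.antitone (by norm_num) x.2⟩
      map_add' := fun x y => rfl
      map_smul' := fun c x => rfl }
  have hι : ∀ x, ‖ι x‖ ≤ ‖x‖ := by
    intro x
    rw [Lp.norm_def, Lp.norm_def]
    refine ENNReal.toReal_mono (Lp.eLpNorm_ne_top x) ?_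
    exact eLpNorm_le_eLpNorm_of_exponent_le (by norm_num) (Lp.aestronglyMeasurable x)
  let h : StrongDual ℝ (Lp ℝ 2 P) := (g ∘ₗ ι).mkContinuous l fun x =>
    (hbound _).trans (mul_le_mul_of_nonneg_left (hι x) hl0)
  let z : Lp ℝ 2 P := (InnerProductSpace.toDual ℝ _).symm h
  have hz : ∀ x, inner ℝ z x = g (ι x) := fun x =>
    InnerProductSpace.toDual_symm_apply
  have hz_int : Integrable z P := (Lp.memLp z).integrable (by norm_num)
  have hιind : ∀ s (hs : MeasurableSet s), ι (indicatorConstLp 2 hs (measure_ne_top P s) (1 : ℝ)) =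
      indicatorConstLp 1 hs (measure_ne_top P s) (1 : ℝ) := fun s hs => rfl
  have hset : ∀ s (hs : MeasurableSet s), ∫ ω in s, z ω ∂P =
      g (indicatorConstLp 1 hs (measure_ne_top P s) (1 : ℝ)) := by
    intro s hs
    rw [← hιind, ← hz, real_inner_comm, L2.inner_indicatorConstLp_one]
  -- Indicators decide the bounds on `z`: `P(A) = E[U_l(1_A)] ≤ g(1_A) ≤ l P(A)`.
  have hlow : ∀ᵐ ω ∂P, 1 ≤ z ω := by
    refine ae_le_of_forall_setIntegral_le (f := fun _ => (1 : ℝ)) (integrable_const _) hz_int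
      fun s hs _ => ?_
    rw [hset s hs]
    refine le_trans (le_of_eq ?_) (hg _)
    rw [expectedUtility_congr indicatorConstLp_coeFn, expectedUtility, ← integral_indicator hs]
    refine integral_congr_ae (ae_of_all _ fun ω => ?_)
    exact (utility_of_nonneg l (Set.indicator_nonneg (fun _ _ => zero_le_one) _)).symm
  have hupp : ∀ᵐ ω ∂P, z ω ≤ l := by
    refine ae_le_of_forall_setIntegral_le (g := fun _ => l) hz_int (integrable_const _)
      fun s hs _ => ?_
    rw [hset s hs]
    refine (hupper _).trans (le_of_eq ?_)
    rw [norm_indicatorConstLp (by norm_num) (by norm_num)]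
    simp [mul_comm]
  -- Truncation changes `z` only on a null set and makes the bounds hold everywhere.
  refine ⟨fun ω => max 1 (min l (z ω)), ?_, fun ω => ⟨le_max_left _ _,
    max_le hl (min_le_left _ _)⟩, ?_⟩
  · exact measurable_const.max (measurable_const.min (Lp.stronglyMeasurable z).measurable)
  have hZz : ∀ᵐ ω ∂P, max 1 (min l (z ω)) = z ω := by
    filter_upwards [hlow, hupp] with ω h1 h2
    rw [min_eq_right h2, max_eq_right h1]
  intro X hX
  have hcongr : ∫ ω, max 1 (min l (z ω)) * X ω ∂P = ∫ ω, z ω * X ω ∂P :=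
    integral_congr_ae (hZz.mono fun ω hω => by simp only [hω])
  rw [hcongr]
  have hzX : ∀ Y : Ω → ℝ, Integrable Y P → Integrable (fun ω => z ω * Y ω) P := fun Y hY =>
    hY.bdd_mul (c := l) hz_int.aestronglyMeasurable (by
      filter_upwards [hlow, hupp] with ω h1 h2
      rw [Real.norm_eq_abs, abs_of_nonneg (by linarith)]
      exact h2)
  let R : Lp ℝ 1 P →L[ℝ] ℝ := LinearMap.mkContinuous
    { toFun := fun Y => ∫ ω, z ω * Y ω ∂P
      map_add' := fun Y Y' => by
        rw [← integral_add (hzX _ (L1.integrable_coeFn Y)) (hzX _ (L1.integrable_coeFn Y'))]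
        refine integral_congr_ae ((Lp.coeFn_add Y Y').mono fun ω hω => ?_)
        simp only [hω, Pi.add_apply, mul_add]
      map_smul' := fun c Y => by
        rw [RingHom.id_apply, smul_eq_mul, ← integral_const_mul]
        refine integral_congr_ae ((Lp.coeFn_smul c Y).mono fun ω hω => ?_)
        simp only [hω, Pi.smul_apply, smul_eq_mul]
        ring } l (fun Y => by
      rw [L1.norm_eq_integral_norm, ← integral_const_mul]
      refine norm_integral_le_of_norm_le ((L1.integrable_coeFn Y).norm.const_mul l) ?_
      filter_upwards [hlow, hupp] with ω h1 h2
      rw [norm_mul, Real.norm_eq_abs (z ω), abs_of_nonneg (by linarith)]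
      exact mul_le_mul_of_nonneg_right h2 (norm_nonneg _))
  -- Both functionals are continuous on `L¹` and agree on indicators, hence everywhere by density of
  -- simple functions.
  have hGR : ∀ Y : Lp ℝ 1 P, G Y = R Y := by
    intro Y
    refine Lp.induction (p := 1) (by norm_num) (motive := fun Y => G Y = R Y) ?_ ?_ ?_ Y
    · intro c s hs hμs
      have hc : ((Lp.simpleFunc.indicatorConst 1 hs hμs.ne c : Lp.simpleFunc ℝ 1 P) : Lp ℝ 1 P) =
          c • indicatorConstLp 1 hs hμs.ne (1 : ℝ) := by
        rw [Lp.simpleFunc.coe_indicatorConst]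
        ext1
        filter_upwards [indicatorConstLp_coeFn (p := 1) (hs := hs) (hμs := hμs.ne) (c := c),
          indicatorConstLp_coeFn (p := 1) (hs := hs) (hμs := hμs.ne) (c := (1 : ℝ)),
          Lp.coeFn_smul c (indicatorConstLp 1 hs hμs.ne (1 : ℝ))] with ω h1 h2 h3
        rw [h1, h3, Pi.smul_apply, h2]
        by_cases hωs : ω ∈ s <;> simp [hωs]
      rw [hc, map_smul, map_smul]
      congr 1
      rw [hGg, ← hset s hs]
      change _ = ∫ ω, z ω * _ ∂P
      rw [← integral_indicator hs]
      refine integral_congr_ae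
        ((indicatorConstLp_coeFn (p := 1) (hs := hs) (hμs := hμs.ne) (c := (1 : ℝ))).mono
          fun ω hω => ?_)
      simp only [hω]
      by_cases hωs : ω ∈ s <;> simp [hωs]
    · intro f f' hf hf' _ h1 h2
      rw [map_add, map_add, h1, h2]
    · exact isClosed_eq G.continuous R.continuous
  calc g (hX.toL1 X) = R (hX.toL1 X) := hGR _
    _ = ∫ ω, z ω * X ω ∂P :=
      integral_congr_ae (hX.coeFn_toL1.mono fun ω hω => by simp only [hω])

/-- If no claim `B + K`, `K` in a linear space of integrable claims, has positive expected utility,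
then there is a density with values in `[1, l]` which annihilates this linear space and gives
`B` a nonpositive price. -/
theorem exists_density_of_expectedUtility_add_nonpos {Ω : Type*} {m : MeasurableSpace Ω}
    {P : Measure Ω} [IsProbabilityMeasure P] {l : ℝ} (hl : 1 ≤ l) (𝒦 : Submodule ℝ (Ω → ℝ))
    (h𝒦 : ∀ K ∈ 𝒦, Integrable K P) {B : Ω → ℝ} (hB : Integrable B P)
    (h : ∀ K ∈ 𝒦, expectedUtility P l (B + K) ≤ 0) :
    ∃ Z : Ω → ℝ, Measurable Z ∧ (∀ ω, 1 ≤ Z ω ∧ Z ω ≤ l) ∧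
      (∀ K ∈ 𝒦, ∫ ω, Z ω * K ω ∂P = 0) ∧ ∫ ω, Z ω * B ω ∂P ≤ 0 := by
  have hl0 : 0 ≤ l := by linarith
  -- This is the face `t = 0` of the cone below; for `t > 0`, homogeneity reduces `tB + K` to `B +
  -- t⁻¹K`.
  have h0 : ∀ K ∈ 𝒦, expectedUtility P l K ≤ 0 := by
    intro K hK
    by_contra! hpos
    obtain ⟨t, -, ht⟩ := exists_expectedUtility_add_mul_pos hl0 (h𝒦 K hK) hB hpos
    exact absurd (h (t • K) (𝒦.smul_mem t hK)) (not_le.2 ht)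
  let C : PointedCone ℝ (Lp ℝ 1 P) :=
    { carrier := {X | ∃ t : ℝ, 0 ≤ t ∧ ∃ K ∈ 𝒦, X =ᵐ[P] t • B + K}
      zero_mem' := ⟨0, le_rfl, 0, 𝒦.zero_mem, by simpa using Lp.coeFn_zero ℝ 1 P⟩
      smul_mem' := by
        rintro ⟨a, ha⟩ X ⟨t, ht, K, hK, hX⟩
        refine ⟨a * t, mul_nonneg ha ht, a • K, 𝒦.smul_mem a hK, ?_⟩
        filter_upwards [hX, Lp.coeFn_smul a X] with ω h1 h2
        change (a • X : Lp ℝ 1 P) ω = _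
        rw [h2]
        simp only [Pi.smul_apply, h1, Pi.add_apply, smul_eq_mul]
        ring
      add_mem' := by
        rintro X X' ⟨t, ht, K, hK, hX⟩ ⟨t', ht', K', hK', hX'⟩
        refine ⟨t + t', add_nonneg ht ht', K + K', 𝒦.add_mem hK hK', ?_⟩
        filter_upwards [hX, hX', Lp.coeFn_add X X'] with ω h1 h1' h2
        rw [h2]
        simp only [Pi.smul_apply, h1, h1', Pi.add_apply, smul_eq_mul]
        ring }
  have hCmem : ∀ (X : Ω → ℝ) (hX : Integrable X P) (t : ℝ), 0 ≤ t → ∀ K ∈ 𝒦, X = t • B + K →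
      hX.toL1 X ∈ C := fun X hX t ht K hK hXe =>
    ⟨t, ht, K, hK, hX.coeFn_toL1.trans (by rw [hXe])⟩
  obtain ⟨f, hf, hfC⟩ := exists_linear_le_sublinear_of_nonneg_on_cone
    (fun X : Lp ℝ 1 P => -expectedUtility P l X) C
    (by
      rw [expectedUtility_congr (Lp.coeFn_zero ℝ 1 P)]
      simp [expectedUtility, utility])
    (by
      intro c hc X
      have : expectedUtility P l (c • X : Lp ℝ 1 P) = c * expectedUtility P l X := by
        rw [← expectedUtility_const_mul hc.le]
        exact expectedUtility_congr (Lp.coeFn_smul c X)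
      rw [this]
      ring)
    (by
      intro X Y
      have := expectedUtility_add_le hl (L1.integrable_coeFn X) (L1.integrable_coeFn Y)
      rw [expectedUtility_congr (Lp.coeFn_add X Y)]
      change -expectedUtility P l (fun ω => X ω + Y ω) ≤ _
      linarith)
    (by
      rintro X ⟨t, ht, K, hK, hX⟩
      rw [neg_nonneg, expectedUtility_congr hX]
      rcases eq_or_lt_of_le ht with ht0 | ht0
      · rw [← ht0, zero_smul, zero_add]
        exact h0 K hK
      · have : t • B + K = fun ω => t * (B + t⁻¹ • K) ω := by
          ext ω
          simp only [Pi.add_apply, Pi.smul_apply, smul_eq_mul]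
          field_simp
        rw [this, expectedUtility_const_mul ht]
        exact mul_nonpos_of_nonneg_of_nonpos ht (h _ (𝒦.smul_mem _ hK)))
  obtain ⟨Z, hZm, hZ, hZf⟩ := exists_density_of_expectedUtility_le hl (-f) fun (X : Lp ℝ 1 P) => by
    have := hf X
    simp only [LinearMap.neg_apply]
    linarith
  refine ⟨Z, hZm, hZ, fun K hK => ?_, ?_⟩
  · have key : ∀ K ∈ 𝒦, ∫ ω, Z ω * K ω ∂P ≤ 0 := by
      intro K hK
      have := hfC _ (hCmem K (h𝒦 K hK) 0 le_rfl K hK (by simp))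
      rw [← hZf K (h𝒦 K hK)]
      simpa using this
    refine le_antisymm (key K hK) ?_
    have := key (-K) (𝒦.neg_mem hK)
    simpa [integral_neg] using this
  · have := hfC _ (hCmem B hB 1 zero_le_one 0 𝒦.zero_mem (by simp))
    rw [← hZf B hB]
    simpa using this

end GainLoss

namespace GainLoss

/-! ### The gains form a linear space -/

theorem sum_succ_sub_castSucc {E : Type*} [AddCommGroup E] {N : ℕ} (f : Fin (N + 1) → E) :
    ∑ k : Fin N, (f k.succ - f k.castSucc) = f (Fin.last N) - f 0 := by
  induction N with
  | zero => simp
  | succ N ih =>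
    rw [Fin.sum_univ_castSucc]
    have := ih (fun k => f k.castSucc)
    simp only [Fin.succ_castSucc, Fin.castSucc_zero] at this ⊢
    rw [this, Fin.succ_last]
    abel

/-- Each term is the increment of `x` along the points `s k` clamped to `[s p, s q]`, since no step
straddles an endpoint; the sum then telescopes. -/
theorem sum_ite_mem_Ico_sub {E I : Type*} [AddCommGroup E] [LinearOrder I] {N : ℕ}
    {s : Fin (N + 1) → I} (hs : Monotone s) (x : I → E) {p q : Fin (N + 1)} (hpq : s p ≤ s q) :
    ∑ k : Fin N, (if s p ≤ s k.castSucc ∧ s k.castSucc < s q then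
      x (s k.succ) - x (s k.castSucc) else 0) = x (s q) - x (s p) := by
  have hterm : ∀ k : Fin N, (if s p ≤ s k.castSucc ∧ s k.castSucc < s q then
      x (s k.succ) - x (s k.castSucc) else 0) =
      x (max (s p) (min (s k.succ) (s q))) - x (max (s p) (min (s k.castSucc) (s q))) := by
    intro k
    have hk : s k.castSucc ≤ s k.succ := hs k.castSucc_lt_succ.le
    rcases lt_or_ge (s k.castSucc) (s p) with h1 | h1
    · have h2 : s k.succ ≤ s p := hs (Fin.castSucc_lt_iff_succ_le.1 (hs.reflect_lt h1))
      rw [if_neg (fun h => absurd h.1 (not_le.2 h1)), max_eq_left (min_le_of_left_le h2),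
        max_eq_left (min_le_of_left_le h1.le), sub_self]
    · rcases lt_or_ge (s k.castSucc) (s q) with h2 | h2
      · have h3 : s k.succ ≤ s q := hs (Fin.castSucc_lt_iff_succ_le.1 (hs.reflect_lt h2))
        rw [if_pos ⟨h1, h2⟩, min_eq_left h3, min_eq_left h2.le, max_eq_right h1,
          max_eq_right (h1.trans hk)]
      · rw [if_neg (fun h => absurd h.2 (not_lt.2 h2)), min_eq_right h2,
          min_eq_right (h2.trans hk), sub_self]
  rw [Finset.sum_congr rfl fun k _ => hterm k,
    sum_succ_sub_castSucc (fun k => x (max (s p) (min (s k) (s q)))),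
    min_eq_right (hs (Fin.le_last q)), max_eq_right hpq,
    max_eq_left (min_le_of_left_le (hs (Fin.zero_le p)))]

variable {Ω : Type*} {m : MeasurableSpace Ω} {T : ℝ≥0} {d : ℕ} {F : Filtration (Time T) m}
  {S : Time T → Ω → EuclideanSpace ℝ (Fin d)}

/-- A function which is measurable before `τ`, restricted to `{τ ≤ π}`, is measurable
before `π`. -/
theorem measurable_indicator_le_of_stoppingTime {E : Type*} [MeasurableSpace E] [Zero E]
    {τ π : Ω → WithTop (Time T)} (hτ : IsStoppingTime F τ) (hπ : IsStoppingTime F π) {H : Ω → E}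
    (hH : Measurable[hτ.measurableSpace] H) :
    Measurable[hπ.measurableSpace] ({ω | τ ω ≤ π ω}.indicator H) := by
  intro B hB
  rw [Set.indicator_preimage, Set.ite]
  refine MeasurableSet.union ?_ (MeasurableSet.diff ?_ (hτ.measurableSet_stopping_time_le hπ))
  · exact ((hτ.measurableSet_min_iff hπ _).1 (hτ.measurableSet_inter_le hπ _ (hH hB))).2
  · exact (measurable_const (a := (0 : E))) hB

/-- The order statistic of index `k`, counted from zero, is at most `t` iff more than `k` of the `θ
j` are, and this count is `F t`-measurable. -/
theorem isStoppingTime_sort {N : ℕ} {θ : Fin (N + 1) → Ω → Time T}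
    (hθ : ∀ j, IsStoppingTime F (fun ω => ((θ j ω : Time T) : WithTop (Time T))))
    (k : Fin (N + 1)) :
    IsStoppingTime F (fun ω =>
      ((θ (Tuple.sort (fun j => θ j ω) k) ω : Time T) : WithTop (Time T))) := by
  classical
  intro t
  have h : {ω | ((θ (Tuple.sort (fun j => θ j ω) k) ω : Time T) : WithTop (Time T)) ≤ t} =
      {ω | (k : ℕ) < ∑ j, if θ j ω ≤ t then 1 else 0} := by
    ext ω
    have h1 := Tuple.lt_card_le_iff_apply_le_of_monotone (j := k) (a := t)
      (Tuple.monotone_sort (fun j => θ j ω))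
    rw [Finset.card_filter] at h1
    simp only [Function.comp_apply] at h1
    rw [Equiv.sum_comp (Tuple.sort fun j => θ j ω) fun j => if θ j ω ≤ t then 1 else 0] at h1
    simp only [Set.mem_ofPred_eq, WithTop.coe_le_coe]
    exact h1.symm
  rw [h]
  have hm : Measurable[F t] fun ω => ∑ j, if θ j ω ≤ t then (1 : ℕ) else 0 := by
    refine Finset.measurable_sum _ fun j _ => ?_
    refine Measurable.ite ?_ measurable_const measurable_const
    simpa only [WithTop.coe_le_coe] using hθ j t
  exact hm (measurableSet_Ioi (a := (k : ℕ)))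

/-- Finite sums of gains over stochastic intervals, whose endpoints need not be ordered for
different intervals, are gains of simple strategies. -/
theorem sum_mem_gains {N : ℕ} {θ : Fin (N + 1) → Ω → Time T}
    (hθ : ∀ j, IsStoppingTime F (fun ω => ((θ j ω : Time T) : WithTop (Time T))))
    {ι : Type*} [Fintype ι] {a b : ι → Fin (N + 1)} (hab : ∀ i ω, θ (a i) ω ≤ θ (b i) ω)
    {H : ι → Ω → EuclideanSpace ℝ (Fin d)}
    (hH : ∀ i, Measurable[(hθ (a i)).measurableSpace] (H i)) {C : ℝ} (hC : ∀ i ω, ‖H i ω‖ ≤ C) :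
    (fun ω => ∑ i, inner ℝ (H i ω) (S (θ (b i) ω) ω - S (θ (a i) ω) ω)) ∈ gains S F := by
  classical
  let σ : Fin (N + 1) → Ω → Time T := fun k ω => θ (Tuple.sort (fun j => θ j ω) k) ω
  have hσ := fun k => isStoppingTime_sort hθ k
  have hmono : ∀ ω, Monotone fun k => σ k ω := fun ω => Tuple.monotone_sort (fun j => θ j ω)
  have hmem : ∀ j ω, ∃ k, θ j ω = σ k ω := fun j ω =>
    ⟨(Tuple.sort (fun j => θ j ω)).symm j, by simp [σ]⟩
  let ξ : Strategy F d :=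
    { n := N
      τ := σ
      isStoppingTime := hσ
      monotone := hmono
      -- On each interval between consecutive sorted times, the position `H i` is held iff the left
      -- endpoint lies in `[θ (a i), θ (b i))`.
      H := fun k ω => ∑ i, {ω | σ k.castSucc ω < θ (b i) ω}.indicator
        ({ω | θ (a i) ω ≤ σ k.castSucc ω}.indicator (H i)) ω
      measurable_H := by
        intro k
        refine Finset.measurable_fun_sum _ fun i _ => Measurable.indicator ?_ ?_
        · have := measurable_indicator_le_of_stoppingTime (hθ (a i)) (hσ k.castSucc) (hH i)
          simpa only [WithTop.coe_le_coe] using this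
        · have := ((hθ (b i)).measurableSet_stopping_time_le (hσ k.castSucc)).compl
          simpa only [WithTop.coe_le_coe, Set.compl_ofPred, not_le] using this
      bounded_H := by
        refine ⟨∑ _i : ι, C, fun k ω => (norm_sum_le _ _).trans (Finset.sum_le_sum fun i _ => ?_)⟩
        exact (norm_indicator_le_norm_self _ _).trans
          ((norm_indicator_le_norm_self _ _).trans (hC i ω)) }
  refine ⟨ξ, funext fun ω => ?_⟩
  change _ = ∑ k : Fin N, inner ℝ (∑ i, {ω | σ k.castSucc ω < θ (b i) ω}.indicator
    ({ω | θ (a i) ω ≤ σ k.castSucc ω}.indicator (H i)) ω)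
      (S (σ k.succ ω) ω - S (σ k.castSucc ω) ω)
  simp only [sum_inner]
  rw [Finset.sum_comm]
  refine Finset.sum_congr rfl fun i _ => ?_
  obtain ⟨p, hp⟩ := hmem (a i) ω
  obtain ⟨q, hq⟩ := hmem (b i) ω
  have hpq : σ p ω ≤ σ q ω := hp ▸ hq ▸ hab i ω
  rw [hp, hq, ← sum_ite_mem_Ico_sub (hmono ω) (fun t => S t ω) hpq, inner_sum]
  refine Finset.sum_congr rfl fun k _ => ?_
  by_cases h1 : σ p ω ≤ σ k.castSucc ω <;> by_cases h2 : σ k.castSucc ω < σ q ω <;>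
    simp [hp, hq, h1, h2]

theorem add_mem_gains {K K' : Ω → ℝ} (hK : K ∈ gains S F) (hK' : K' ∈ gains S F) :
    K + K' ∈ gains S F := by
  obtain ⟨ξ, rfl⟩ := hK
  obtain ⟨ξ', rfl⟩ := hK'
  obtain ⟨C, hC⟩ := ξ.bounded_H
  obtain ⟨C', hC'⟩ := ξ'.bounded_H
  let e : Fin (ξ.n + 1) ⊕ Fin (ξ'.n + 1) ≃ Fin ((ξ.n + 1 + ξ'.n) + 1) := finSumFinEquiv
  let θ : Fin ((ξ.n + 1 + ξ'.n) + 1) → Ω → Time T := fun j => Sum.elim ξ.τ ξ'.τ (e.symm j)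
  have hl : ∀ j, θ (e (Sum.inl j)) = ξ.τ j := fun j => by simp [θ]
  have hr : ∀ j, θ (e (Sum.inr j)) = ξ'.τ j := fun j => by simp [θ]
  have hθ : ∀ j, IsStoppingTime F (fun ω => ((θ j ω : Time T) : WithTop (Time T))) := by
    intro j
    obtain ⟨j | j, rfl⟩ := e.surjective j
    · rw [hl]
      exact ξ.isStoppingTime j
    · rw [hr]
      exact ξ'.isStoppingTime j
  have key := sum_mem_gains (S := S) hθ (ι := Fin ξ.n ⊕ Fin ξ'.n)
    (a := Sum.elim (fun i => e (Sum.inl i.castSucc)) (fun i => e (Sum.inr i.castSucc)))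
    (b := Sum.elim (fun i => e (Sum.inl i.succ)) (fun i => e (Sum.inr i.succ)))
    (by
      rintro (i | i) ω
      · simpa only [Sum.elim_inl, hl] using ξ.monotone ω i.castSucc_lt_succ.le
      · simpa only [Sum.elim_inr, hr] using ξ'.monotone ω i.castSucc_lt_succ.le)
    (H := Sum.elim ξ.H ξ'.H)
    (by
      rintro (i | i)
      · exact (ξ.measurable_H i).mono (IsStoppingTime.measurableSpace_mono _ _
          fun ω => by simp [hl]) le_rfl
      · exact (ξ'.measurable_H i).mono (IsStoppingTime.measurableSpace_mono _ _
          fun ω => by simp [hr]) le_rfl)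
    (C := max C C')
    (by
      rintro (i | i) ω
      · exact (hC i ω).trans (le_max_left _ _)
      · exact (hC' i ω).trans (le_max_right _ _))
  convert key using 1
  ext ω
  simp only [Pi.add_apply, Strategy.gain, Fintype.sum_sum_type, Sum.elim_inl, Sum.elim_inr, hl, hr]

theorem smul_mem_gains (c : ℝ) {K : Ω → ℝ} (hK : K ∈ gains S F) : c • K ∈ gains S F := by
  obtain ⟨ξ, rfl⟩ := hK
  refine ⟨{ ξ with
    H := fun i ω => c • ξ.H i ω
    measurable_H := fun i => (ξ.measurable_H i).const_smul c
    bounded_H := ?_ }, ?_⟩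
  · obtain ⟨C, hC⟩ := ξ.bounded_H
    refine ⟨|c| * C, fun i ω => ?_⟩
    rw [norm_smul]
    exact mul_le_mul_of_nonneg_left (hC i ω) (abs_nonneg c)
  · ext ω
    simp [Strategy.gain, Finset.mul_sum, inner_smul_left]

/-- The gain of a single trade over a stochastic interval. -/
theorem inner_sub_mem_gains {a b : Ω → Time T}
    (ha : IsStoppingTime F (fun ω => ((a ω : Time T) : WithTop (Time T))))
    (hb : IsStoppingTime F (fun ω => ((b ω : Time T) : WithTop (Time T)))) (hab : ∀ ω, a ω ≤ b ω)
    {H : Ω → EuclideanSpace ℝ (Fin d)} (hH : Measurable[ha.measurableSpace] H) {C : ℝ}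
    (hC : ∀ ω, ‖H ω‖ ≤ C) :
    (fun ω => inner ℝ (H ω) (S (b ω) ω - S (a ω) ω)) ∈ gains S F := by
  have key := sum_mem_gains (S := S) (F := F) (N := 1) (θ := ![a, b])
    (by
      intro j
      fin_cases j
      · exact ha
      · exact hb)
    (ι := Unit) (a := fun _ => 0) (b := fun _ => 1) (fun _ => hab) (H := fun _ => H)
    (fun _ => hH) (fun _ => hC)
  simpa using key

theorem zero_mem_gains : (0 : Ω → ℝ) ∈ gains S F := by
  have := inner_sub_mem_gains (F := F) (S := S) (a := fun _ => ⊥) (b := fun _ => ⊥)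
    (isStoppingTime_const F ⊥) (isStoppingTime_const F ⊥) (fun _ => le_rfl) (H := fun _ => 0)
    measurable_const (C := 0) (by simp)
  simp only [inner_zero_left] at this
  exact this

variable (S F) in
/-- The linear space of gains. -/
def gainsSubmodule : Submodule ℝ (Ω → ℝ) where
  carrier := gains S F
  add_mem' := add_mem_gains
  zero_mem' := zero_mem_gains
  smul_mem' := fun c _ => smul_mem_gains c

end GainLoss

namespace GainLoss

/-! ### Approximation of times by a grid -/

/-- The points `min (k / (n + 1)) T` of a grid of mesh `1 / (n + 1)` in `[0, T]`. -/
noncomputable def gridPoint (T : ℝ≥0) (n k : ℕ) : Time T :=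
  ⟨min (k / (n + 1)) T, Set.mem_Iic.2 (min_le_right _ _)⟩

/-- The index of the first grid point at or after the time `u`. -/
noncomputable def gridIndex {T : ℝ≥0} (n : ℕ) (u : Time T) : ℕ := ⌈(u : ℝ≥0) * (n + 1)⌉₊

variable {T : ℝ≥0}

theorem gridPoint_lt_iff (n k : ℕ) (u : Time T) : gridPoint T n k < u ↔ k < gridIndex n u := by
  have hu : (u : ℝ≥0) ≤ T := u.2
  rw [gridIndex, Nat.lt_ceil, ← Subtype.coe_lt_coe, gridPoint, min_lt_iff, or_iff_left hu.not_gt,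
    div_lt_iff₀ (by positivity)]

theorem le_gridPoint_gridIndex (n : ℕ) (u : Time T) : u ≤ gridPoint T n (gridIndex n u) :=
  not_lt.1 fun h => lt_irrefl _ ((gridPoint_lt_iff n _ u).1 h)

theorem gridIndex_le (n : ℕ) (u : Time T) : gridIndex n u ≤ ⌈T * (n + 1)⌉₊ :=
  Nat.ceil_mono (mul_le_mul_left u.2 _)

/-- The approximation is from the right, so right continuity of the paths suffices to pass to the
limit. -/
theorem tendsto_gridPoint_gridIndex (u : Time T) :
    Tendsto (fun n => gridPoint T n (gridIndex n u)) atTop (𝓝[≥] u) := by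
  refine tendsto_nhdsWithin_iff.2 ⟨?_, Eventually.of_forall fun n => le_gridPoint_gridIndex n u⟩
  rw [tendsto_subtype_rng]
  have hlim : Tendsto (fun n : ℕ => (u : ℝ≥0) + 1 / ((n : ℝ≥0) + 1)) atTop (𝓝 (u + 0)) :=
    tendsto_const_nhds.add tendsto_one_div_add_atTop_nhds_zero_nat
  rw [add_zero] at hlim
  refine tendsto_of_tendsto_of_tendsto_of_le_of_le tendsto_const_nhds hlim
    (fun n => le_gridPoint_gridIndex n u) fun n => ?_
  refine (min_le_left _ _).trans ?_
  rw [div_le_iff₀ (by positivity), add_mul, one_div, inv_mul_cancel₀ (by positivity)]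
  exact (Nat.ceil_lt_add_one zero_le).le

theorem sum_ite_gridPoint_lt {E : Type*} [AddCommGroup E] (x : Time T → E) (n : ℕ) (u : Time T) :
    ∑ k ∈ Finset.range ⌈T * (n + 1)⌉₊, (if gridPoint T n k < u then
      x (gridPoint T n (k + 1)) - x (gridPoint T n k) else 0) =
      x (gridPoint T n (gridIndex n u)) - x (gridPoint T n 0) := by
  simp only [gridPoint_lt_iff]
  rw [← Finset.sum_filter, ← Finset.sum_range_sub (fun k => x (gridPoint T n k))]
  refine Finset.sum_congr ?_ fun _ _ => rfl
  ext k
  have := gridIndex_le n u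
  simp only [Finset.mem_filter, Finset.mem_range]
  omega

theorem sum_ite_le_gridPoint_lt {E : Type*} [AddCommGroup E] (x : Time T → E) (n : ℕ)
    {a b : Time T} (hab : a ≤ b) :
    ∑ k ∈ Finset.range ⌈T * (n + 1)⌉₊, (if a ≤ gridPoint T n k ∧ gridPoint T n k < b then
      x (gridPoint T n (k + 1)) - x (gridPoint T n k) else 0) =
      x (gridPoint T n (gridIndex n b)) - x (gridPoint T n (gridIndex n a)) := by
  rw [← sub_sub_sub_cancel_right _ _ (x (gridPoint T n 0)), ← sum_ite_gridPoint_lt,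
    ← sum_ite_gridPoint_lt, ← Finset.sum_sub_distrib]
  refine Finset.sum_congr rfl fun k _ => ?_
  rcases lt_or_ge (gridPoint T n k) a with h1 | h1
  · rw [if_neg (fun h => absurd h.1 (not_le.2 h1)), if_pos h1, if_pos (h1.trans_le hab), sub_self]
  · rw [if_neg h1.not_gt, sub_zero]
    simp only [h1, true_and]

/-! ### Integrability of the gains -/

variable {Ω : Type*} {m : MeasurableSpace Ω} {d : ℕ} {F : Filtration (Time T) m}
  {S : Time T → Ω → EuclideanSpace ℝ (Fin d)} {P : Measure Ω}

theorem tendsto_apply_gridPoint {x : Time T → EuclideanSpace ℝ (Fin d)} (hx : IsCadlag x)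
    (u : Time T) : Tendsto (fun n => x (gridPoint T n (gridIndex n u))) atTop (𝓝 (x u)) :=
  (hx u).1.tendsto.comp (tendsto_gridPoint_gridIndex u)

/-- Telescoping turns evaluation at a random time into a finite sum over the events `{gridPoint T n
k < τ}`, so no joint measurability of `S` is needed. -/
theorem stronglyMeasurable_apply_gridPoint (hS : StronglyAdapted F S) {τ : Ω → Time T}
    (hτ : IsStoppingTime F (fun ω => ((τ ω : Time T) : WithTop (Time T)))) (n : ℕ) :
    StronglyMeasurable fun ω => S (gridPoint T n (gridIndex n (τ ω))) ω := by
  have hSm : ∀ t, StronglyMeasurable (S t) := fun t => (hS t).mono (F.le t)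
  have h : (fun ω => S (gridPoint T n (gridIndex n (τ ω))) ω) = fun ω =>
      ∑ k ∈ Finset.range ⌈T * (n + 1)⌉₊, {ω | gridPoint T n k < τ ω}.indicator
        (S (gridPoint T n (k + 1)) - S (gridPoint T n k)) ω + S (gridPoint T n 0) ω := by
    ext1 ω
    have := sum_ite_gridPoint_lt (fun t => S t ω) n (τ ω)
    simp only [Set.indicator_apply, Set.mem_ofPred_eq, Pi.sub_apply]
    rw [this, sub_add_cancel]
  rw [h]
  refine StronglyMeasurable.add (Finset.stronglyMeasurable_fun_sum _ fun k _ => ?_) (hSm _)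
  refine ((hSm _).sub (hSm _)).indicator ?_
  have := F.le _ _ (hτ.measurableSet_gt (gridPoint T n k))
  simpa only [WithTop.coe_lt_coe] using this

theorem integrable_apply_stoppingTime (hS : StronglyAdapted F S)
    (hcad : ∀ᵐ ω ∂P, IsCadlag fun t => S t ω)
    (hint : ∫⁻ ω, maximalFunctional S ω ∂P < ⊤) {τ : Ω → Time T}
    (hτ : IsStoppingTime F (fun ω => ((τ ω : Time T) : WithTop (Time T)))) :
    Integrable (fun ω => S (τ ω) ω) P := by
  refine ⟨aestronglyMeasurable_of_tendsto_ae atTop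
    (fun n => (stronglyMeasurable_apply_gridPoint hS hτ n).aestronglyMeasurable)
    (hcad.mono fun ω hω => tendsto_apply_gridPoint hω (τ ω)), ?_⟩
  refine lt_of_le_of_lt (lintegral_mono fun ω => ?_) hint
  exact le_iSup (fun t : Time T => ‖S t ω‖ₑ) (τ ω)

theorem integrable_inner_of_bounded {H X : Ω → EuclideanSpace ℝ (Fin d)}
    (hH : AEStronglyMeasurable H P) {C : ℝ} (hC : ∀ ω, ‖H ω‖ ≤ C) (hX : Integrable X P) :
    Integrable (fun ω => inner ℝ (H ω) (X ω)) P := by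
  refine Integrable.mono' (hX.norm.const_mul C) (hH.inner hX.aestronglyMeasurable)
    (ae_of_all _ fun ω => ?_)
  exact (norm_inner_le_norm _ _).trans (mul_le_mul_of_nonneg_right (hC ω) (norm_nonneg _))

theorem integrable_gain_summand (hS : StronglyAdapted F S)
    (hcad : ∀ᵐ ω ∂P, IsCadlag fun t => S t ω)
    (hint : ∫⁻ ω, maximalFunctional S ω ∂P < ⊤) (ξ : Strategy F d) (i : Fin ξ.n) :
    Integrable (fun ω => inner ℝ (ξ.H i ω) (S (ξ.τ i.succ ω) ω - S (ξ.τ i.castSucc ω) ω)) P := by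
  obtain ⟨C, hC⟩ := ξ.bounded_H
  refine integrable_inner_of_bounded ?_ (hC i)
    ((integrable_apply_stoppingTime hS hcad hint (ξ.isStoppingTime _)).sub
      (integrable_apply_stoppingTime hS hcad hint (ξ.isStoppingTime _)))
  exact ((ξ.measurable_H i).mono (ξ.isStoppingTime _).measurableSpace_le
    le_rfl).aestronglyMeasurable

theorem integrable_of_mem_gains (hS : StronglyAdapted F S)
    (hcad : ∀ᵐ ω ∂P, IsCadlag fun t => S t ω)
    (hint : ∫⁻ ω, maximalFunctional S ω ∂P < ⊤) {K : Ω → ℝ} (hK : K ∈ gains S F) :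
    Integrable K P := by
  obtain ⟨ξ, rfl⟩ := hK
  exact integrable_finsetSum _ fun i _ => integrable_gain_summand hS hcad hint ξ i

/-! ### Martingale measures annihilate the gains -/

theorem integral_inner_martingale_sub_eq_zero [IsFiniteMeasure P] (hM : Martingale S F P)
    {s t : Time T} (hst : s ≤ t) {G : Ω → EuclideanSpace ℝ (Fin d)}
    (hG : StronglyMeasurable[F s] G) {C : ℝ} (hC : ∀ ω, ‖G ω‖ ≤ C) :
    ∫ ω, inner ℝ (G ω) (S t ω - S s ω) ∂P = 0 := by
  have hX : Integrable (S t - S s) P := (hM.integrable t).sub (hM.integrable s)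
  have hGX := integrable_inner_of_bounded ((hG.mono (F.le s)).aestronglyMeasurable) hC hX
  have h1 := condExp_bilin_of_stronglyMeasurable_left (innerSL ℝ) hG
    (by exact hGX) hX
  have h2 : P[S t - S s | F s] =ᵐ[P] 0 := by
    filter_upwards [condExp_sub (hM.integrable t) (hM.integrable s) (F s), hM.2 s t hst,
      hM.2 s s le_rfl] with ω h1 h2 h3
    rw [h1, Pi.sub_apply, h2, h3, sub_self, Pi.zero_apply]
  calc ∫ ω, inner ℝ (G ω) (S t ω - S s ω) ∂P
      = ∫ ω, (P[fun ω => innerSL ℝ (G ω) ((S t - S s) ω) | F s]) ω ∂P :=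
        (integral_condExp (F.le s)).symm
    _ = ∫ _ω, (0 : ℝ) ∂P := by
        refine integral_congr_ae ?_
        filter_upwards [h1, h2] with ω h1 h2
        rw [h1, h2, Pi.zero_apply, map_zero]
    _ = 0 := integral_zero _ _

/-- Optional sampling by discretization: on a grid the gain is a finite sum of trades between
deterministic times, each of mean zero, and dominated convergence removes the grid. -/
theorem integral_inner_stopped_sub_eq_zero [IsFiniteMeasure P] (hM : Martingale S F P)
    (hcad : ∀ᵐ ω ∂P, IsCadlag fun t => S t ω)
    (hint : ∫⁻ ω, maximalFunctional S ω ∂P < ⊤) {a b : Ω → Time T}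
    (ha : IsStoppingTime F (fun ω => ((a ω : Time T) : WithTop (Time T))))
    (hb : IsStoppingTime F (fun ω => ((b ω : Time T) : WithTop (Time T)))) (hab : ∀ ω, a ω ≤ b ω)
    {H : Ω → EuclideanSpace ℝ (Fin d)} (hH : Measurable[ha.measurableSpace] H) {C : ℝ}
    (hC : ∀ ω, ‖H ω‖ ≤ C) :
    ∫ ω, inner ℝ (H ω) (S (b ω) ω - S (a ω) ω) ∂P = 0 := by
  have hHm : StronglyMeasurable H := (hH.mono ha.measurableSpace_le le_rfl).stronglyMeasurable
  have hC0 : ∀ ω : Ω, 0 ≤ C := fun ω => (norm_nonneg _).trans (hC ω)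
  have hSm : ∀ t, StronglyMeasurable (S t) := fun t => (hM.1 t).mono (F.le t)
  have hgrid : ∀ n : ℕ, ∫ ω, inner ℝ (H ω) (S (gridPoint T n (gridIndex n (b ω))) ω -
      S (gridPoint T n (gridIndex n (a ω))) ω) ∂P = 0 := by
    intro n
    let G : ℕ → Ω → EuclideanSpace ℝ (Fin d) := fun k =>
      {ω | gridPoint T n k < b ω}.indicator ({ω | a ω ≤ gridPoint T n k}.indicator H)
    have hGm : ∀ k, StronglyMeasurable[F (gridPoint T n k)] (G k) := by
      intro k
      have h1 := measurable_indicator_le_of_stoppingTime ha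
        (isStoppingTime_const F (gridPoint T n k)) hH
      rw [IsStoppingTime.measurableSpace_const] at h1
      have h2 := hb.measurableSet_gt (gridPoint T n k)
      simp only [WithTop.coe_le_coe, WithTop.coe_lt_coe] at h1 h2
      exact (h1.indicator h2).stronglyMeasurable
    have hGC : ∀ k ω, ‖G k ω‖ ≤ C := fun k ω =>
      (norm_indicator_le_norm_self _ _).trans ((norm_indicator_le_norm_self _ _).trans (hC ω))
    have hmono : ∀ k, gridPoint T n k ≤ gridPoint T n (k + 1) := fun k => by
      change min ((k : ℝ≥0) / (n + 1)) T ≤ min (((k + 1 : ℕ) : ℝ≥0) / (n + 1)) T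
      refine min_le_min_right _ ?_
      gcongr
      simp
    have hsum : ∀ ω, inner ℝ (H ω) (S (gridPoint T n (gridIndex n (b ω))) ω -
        S (gridPoint T n (gridIndex n (a ω))) ω) = ∑ k ∈ Finset.range ⌈T * (n + 1)⌉₊,
          inner ℝ (G k ω) (S (gridPoint T n (k + 1)) ω - S (gridPoint T n k) ω) := by
      intro ω
      rw [← sum_ite_le_gridPoint_lt (fun t => S t ω) n (hab ω), inner_sum]
      refine Finset.sum_congr rfl fun k _ => ?_
      by_cases h1 : a ω ≤ gridPoint T n k <;> by_cases h2 : gridPoint T n k < b ω <;>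
        simp [G, h1, h2]
    simp only [hsum]
    rw [integral_finsetSum]
    · exact Finset.sum_eq_zero fun k _ =>
        integral_inner_martingale_sub_eq_zero hM (hmono k) (hGm k) (hGC k)
    · intro k _
      exact integrable_inner_of_bounded ((hGm k).mono (F.le _)).aestronglyMeasurable (hGC k)
        ((hM.integrable _).sub (hM.integrable _))
  -- The supremum over the countably many grid points is a measurable dominating function; the full
  -- maximal functional is not assumed measurable.
  let Y : Ω → ℝ≥0∞ := fun ω => ⨆ p : ℕ × ℕ, ‖S (gridPoint T p.1 p.2) ω‖ₑ
  have hYm : Measurable Y := Measurable.iSup fun p => (hSm _).measurable.enorm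
  have hY : ∫⁻ ω, Y ω ∂P ≠ ⊤ := by
    refine (lt_of_le_of_lt (lintegral_mono fun ω => ?_) hint).ne
    exact iSup_le fun p => le_iSup (fun t : Time T => ‖S t ω‖ₑ) _
  have hYtop := ae_lt_top hYm hY
  have hle : ∀ ω, Y ω < ⊤ → ∀ n k, ‖S (gridPoint T n k) ω‖ ≤ (Y ω).toReal := by
    intro ω hω n k
    rw [← toReal_enorm]
    exact ENNReal.toReal_mono hω.ne (le_iSup (fun p : ℕ × ℕ => ‖S (gridPoint T p.1 p.2) ω‖ₑ) (n, k))
  refine tendsto_nhds_unique (tendsto_integral_of_dominated_convergence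
    (F := fun n ω => inner ℝ (H ω) (S (gridPoint T n (gridIndex n (b ω))) ω -
      S (gridPoint T n (gridIndex n (a ω))) ω)) (fun ω => C * (2 * (Y ω).toReal)) ?_ ?_ ?_ ?_) ?_
  · exact fun n => (hHm.inner ((stronglyMeasurable_apply_gridPoint hM.1 hb n).sub
      (stronglyMeasurable_apply_gridPoint hM.1 ha n))).aestronglyMeasurable
  · exact ((integrable_toReal_of_lintegral_ne_top hYm.aemeasurable hY).const_mul 2).const_mul C
  · intro n
    filter_upwards [hYtop] with ω hω
    refine (norm_inner_le_norm _ _).trans (mul_le_mul (hC ω) ?_ (norm_nonneg _) (hC0 ω))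
    refine (norm_sub_le _ _).trans ?_
    rw [two_mul]
    exact add_le_add (hle ω hω _ _) (hle ω hω _ _)
  · filter_upwards [hcad] with ω hω
    exact tendsto_const_nhds.inner
      ((tendsto_apply_gridPoint hω (b ω)).sub (tendsto_apply_gridPoint hω (a ω)))
  · simp only [hgrid]
    exact tendsto_const_nhds

theorem integral_eq_zero_of_mem_gains [IsFiniteMeasure P] (hM : Martingale S F P)
    (hcad : ∀ᵐ ω ∂P, IsCadlag fun t => S t ω)
    (hint : ∫⁻ ω, maximalFunctional S ω ∂P < ⊤) {K : Ω → ℝ} (hK : K ∈ gains S F) :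
    ∫ ω, K ω ∂P = 0 := by
  obtain ⟨ξ, rfl⟩ := hK
  obtain ⟨C, hC⟩ := ξ.bounded_H
  simp only [Strategy.gain]
  rw [integral_finsetSum _ fun i _ => integrable_gain_summand hM.1 hcad hint ξ i]
  exact Finset.sum_eq_zero fun i _ => integral_inner_stopped_sub_eq_zero hM hcad hint
    (ξ.isStoppingTime _) (ξ.isStoppingTime _) (fun ω => ξ.monotone ω i.castSucc_lt_succ.le)
    (ξ.measurable_H i) (hC i)

/-- A process is a martingale under a measure which annihilates the gains. -/
theorem martingale_of_integral_gains_eq_zero [IsFiniteMeasure P] (hS : StronglyAdapted F S)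
    (hcad : ∀ᵐ ω ∂P, IsCadlag fun t => S t ω)
    (hint : ∫⁻ ω, maximalFunctional S ω ∂P < ⊤)
    (h : ∀ K ∈ gains S F, ∫ ω, K ω ∂P = 0) : Martingale S F P := by
  have hSi : ∀ t, Integrable (S t) P := fun t =>
    integrable_apply_stoppingTime hS hcad hint (isStoppingTime_const F t)
  refine ⟨hS, fun s t hst => ?_⟩
  refine (ae_eq_condExp_of_forall_setIntegral_eq (F.le s) (hSi t)
    (fun _ _ _ => (hSi s).integrableOn) (fun A hA _ => ?_) (hS s).aestronglyMeasurable).symm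
  refine ext_inner_left ℝ fun v => ?_
  rw [← integral_inner (hSi s).integrableOn, ← integral_inner (hSi t).integrableOn]
  have hG : StronglyMeasurable[F s] (A.indicator fun _ => v) :=
    stronglyMeasurable_const.indicator hA
  -- Buying `v` at time `s` on the event `A` and selling at `t` tests the martingale property in
  -- direction `v`.
  have key := h _ (inner_sub_mem_gains (S := S) (F := F) (a := fun _ => s) (b := fun _ => t)
    (isStoppingTime_const F s) (isStoppingTime_const F t) (fun _ => hst)
    (H := A.indicator fun _ => v)
    (by
      rw [IsStoppingTime.measurableSpace_const]
      exact hG.measurable)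
    (C := ‖v‖) (fun ω => norm_indicator_le_norm_self (fun _ => v) ω))
  have h1 : ∀ ω, inner ℝ (A.indicator (fun _ => v) ω) (S t ω - S s ω) =
      A.indicator (fun ω => inner ℝ v (S t ω) - inner ℝ v (S s ω)) ω := by
    intro ω
    by_cases hω : ω ∈ A <;> simp [hω, inner_sub_right]
  simp only [h1] at key
  rw [integral_indicator (F.le s _ hA), integral_sub
    ((hSi t).const_inner v).restrict ((hSi s).const_inner v).restrict] at key
  linarith

end GainLoss

namespace GainLoss

/-! ### The gain-loss ratio and the expected utility -/

section Ratio

variable {Ω : Type*} {m : MeasurableSpace Ω} {P : Measure Ω} {X : Ω → ℝ} {l : ℝ}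

theorem lintegral_ofReal_ne_top (hX : Integrable X P) : ∫⁻ ω, ENNReal.ofReal (X ω) ∂P ≠ ⊤ :=
  ((lintegral_ofReal_le_lintegral_enorm X).trans_lt hX.2).ne

theorem integral_posPart_eq (hX : Integrable X P) :
    ∫ ω, (X ω)⁺ ∂P = (∫⁻ ω, ENNReal.ofReal (X ω) ∂P).toReal := by
  rw [integral_eq_lintegral_of_nonneg_ae (ae_of_all _ fun ω => posPart_nonneg _)
    hX.pos_part.aestronglyMeasurable]
  simp only [posPart_def, ENNReal.ofReal_max, ENNReal.ofReal_zero, zero_le, sup_of_le_left]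

theorem expectedUtility_eq (hX : Integrable X P) :
    expectedUtility P l X = (∫⁻ ω, ENNReal.ofReal (X ω) ∂P).toReal -
      l * (∫⁻ ω, ENNReal.ofReal (-X ω) ∂P).toReal := by
  have h1 : Integrable (fun ω => (X ω)⁺) P := hX.pos_part
  have h2 : Integrable (fun ω => (X ω)⁻) P := hX.neg_part
  have h3 := integral_posPart_eq hX.neg
  simp only [Pi.neg_apply, posPart_neg] at h3
  rw [← h3, ← integral_posPart_eq hX, ← integral_const_mul, ← integral_sub h1 (h2.const_mul l)]
  rfl

/-- Both sides say `l E[X⁻] < E[X⁺]`. The conventions `c / 0 = ⊤` for `c > 0` and `0 / 0 = 0` keep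
this valid for vanishing losses and for null `X`. -/
theorem ofReal_lt_gainLossRatio_iff (hl : 0 ≤ l) (hX : Integrable X P) :
    ENNReal.ofReal l < gainLossRatio P X ↔ 0 < expectedUtility P l X := by
  have ha := lintegral_ofReal_ne_top hX
  have hb : ∫⁻ ω, ENNReal.ofReal (-X ω) ∂P ≠ ⊤ := lintegral_ofReal_ne_top hX.neg
  rw [gainLossRatio, ENNReal.lt_div_iff_mul_lt (Or.inr ENNReal.ofReal_ne_top) (Or.inl hb),
    expectedUtility_eq hX,
    sub_pos, ← ENNReal.toReal_lt_toReal (ENNReal.mul_ne_top ENNReal.ofReal_ne_top hb) ha,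
    ENNReal.toReal_mul, ENNReal.toReal_ofReal hl]

theorem one_le_gainLossRatio (hX : Integrable X P) (h0 : ¬ X =ᵐ[P] 0)
    (h : ∫⁻ ω, ENNReal.ofReal (-X ω) ∂P ≤ ∫⁻ ω, ENNReal.ofReal (X ω) ∂P) :
    1 ≤ gainLossRatio P X := by
  have ha := lintegral_ofReal_ne_top hX
  have hne : ∫⁻ ω, ENNReal.ofReal (X ω) ∂P ≠ 0 := by
    intro ha0
    rw [ha0, nonpos_iff_eq_zero,
      lintegral_eq_zero_iff' (f := fun ω => ENNReal.ofReal (-X ω))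
        hX.aemeasurable.neg.ennreal_ofReal] at h
    rw [lintegral_eq_zero_iff' hX.aemeasurable.ennreal_ofReal] at ha0
    refine h0 ?_
    filter_upwards [ha0, h] with ω h1 h2
    simp only [Pi.zero_apply, ENNReal.ofReal_eq_zero] at h1 h2 ⊢
    linarith
  rw [gainLossRatio, ENNReal.le_div_iff_mul_le (Or.inr hne) (Or.inr ha), one_mul]
  exact h

end Ratio

/-! ### Densities with finite entropy -/

theorem conjugate_eq_zero {l y : ℝ} (h1 : 1 ≤ y) (hl : y ≤ l) : conjugate l y = 0 := by
  refine le_antisymm (iSup_le fun x => ?_) (le_iSup_of_le 0 (by simp [utility]))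
  have := utility_le_mul h1 hl x
  exact_mod_cast (by linarith : utility l x - x * y ≤ 0)

/-- The expression `U_l(x) - x y` is unbounded as `x → +∞` if `y < 1`, and as `x → -∞` if `y > l`.
-/
theorem conjugate_eq_top {l y : ℝ} (h : ¬ (1 ≤ y ∧ y ≤ l)) : conjugate l y = ⊤ := by
  refine EReal.eq_top_iff_forall_lt _ |>.2 fun r => ?_
  rw [conjugate, lt_iSup_iff]
  have hr : r < |r| + 1 := (le_abs_self r).trans_lt (lt_add_one _)
  have hr0 : 0 ≤ |r| + 1 := by positivity
  rcases lt_or_ge y 1 with hy | hy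
  · have hy' : 0 < 1 - y := sub_pos.2 hy
    refine ⟨(|r| + 1) / (1 - y), ?_⟩
    rw [utility_of_nonneg l (by positivity), EReal.coe_lt_coe_iff]
    refine hr.trans_eq ?_
    field_simp
  · have hy' : 0 < y - l := sub_pos.2 (not_le.1 fun h' => h ⟨hy, h'⟩)
    refine ⟨-((|r| + 1) / (y - l)), ?_⟩
    rw [utility_of_nonpos l (neg_nonpos.2 (by positivity)), EReal.coe_lt_coe_iff]
    refine hr.trans_eq ?_
    field_simp
    ring

section Density

variable {Ω : Type*} {m : MeasurableSpace Ω} {P Q : Measure Ω} {l : ℝ}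

theorem ae_mem_Icc_of_lintegral_conjugate_lt_top {Z : Ω → ℝ} (hZ : Measurable Z)
    (h : ∫⁻ ω, (conjugate l (Z ω)).toENNReal ∂P < ⊤) : ∀ᵐ ω ∂P, 1 ≤ Z ω ∧ Z ω ≤ l := by
  have hs : MeasurableSet {ω | 1 ≤ Z ω ∧ Z ω ≤ l} :=
    (measurableSet_le measurable_const hZ).inter (measurableSet_le hZ measurable_const)
  have heq : ∀ ω, (conjugate l (Z ω)).toENNReal =
      {ω | 1 ≤ Z ω ∧ Z ω ≤ l}ᶜ.indicator (fun _ => ⊤) ω := by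
    intro ω
    by_cases hω : 1 ≤ Z ω ∧ Z ω ≤ l
    · rw [conjugate_eq_zero hω.1 hω.2, Set.indicator_of_notMem (by simpa using hω)]
      simp
    · rw [conjugate_eq_top hω, Set.indicator_of_mem (by simpa using hω)]
      simp
  simp only [heq] at h
  rw [lintegral_indicator_const hs.compl] at h
  by_contra h0
  rw [ENNReal.top_mul h0] at h
  exact lt_irrefl _ h

theorem le_smul_of_rnDeriv_le [SigmaFinite P] [SigmaFinite Q] (hQ : Q ≪ P) {c : ℝ≥0∞}
    (h : ∀ᵐ ω ∂P, Q.rnDeriv P ω ≤ c) : Q ≤ c • P := by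
  rw [← Measure.withDensity_rnDeriv_eq Q P hQ, ← withDensity_const]
  exact withDensity_mono h

/-- Probability measures with finite entropy are those whose densities are proportional to a
function with values in `[1, l]`. -/
theorem exists_of_mem_finiteEntropy [IsProbabilityMeasure P] (hQ : Q ∈ finiteEntropy P l) :
    ∃ y : ℝ, 0 < y ∧ y ≤ l ∧ Q ≤ ENNReal.ofReal (l / y) • P ∧
      ∀ᵐ ω ∂P, 1 ≤ y * (Q.rnDeriv P ω).toReal ∧ y * (Q.rnDeriv P ω).toReal ≤ l := by
  obtain ⟨hQp, hQP, y, hy, hfin⟩ := hQ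
  have hmem := ae_mem_Icc_of_lintegral_conjugate_lt_top
    ((Measure.measurable_rnDeriv Q P).ennreal_toReal.const_mul y) hfin
  refine ⟨y, hy, ?_, le_smul_of_rnDeriv_le hQP ?_, hmem⟩
  -- The density integrates to `1`, so integrating the upper bound gives `y ≤ l`.
  · have h1 : ∫ ω, y * (Q.rnDeriv P ω).toReal ∂P ≤ ∫ _ω, l ∂P :=
      integral_mono_ae (Measure.integrable_toReal_rnDeriv.const_mul y) (integrable_const l)
        (hmem.mono fun ω hω => hω.2)
    rw [integral_const_mul, Measure.integral_toReal_rnDeriv hQP] at h1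
    simpa using h1
  · filter_upwards [hmem, Measure.rnDeriv_lt_top Q P] with ω h1 h2
    rw [← ENNReal.ofReal_toReal h2.ne]
    refine ENNReal.ofReal_le_ofReal ?_
    rw [le_div_iff₀ hy]
    linarith [h1.2]

/-- Replacing `y` by its bound `l` makes the estimate independent of `Q`, as needed for a strictly
negative supremum in `marketRisk`. -/
theorem expectedUtility_le_of_mem_finiteEntropy [IsProbabilityMeasure P]
    (hQ : Q ∈ finiteEntropy P l) {X : Ω → ℝ} (hX : Integrable X P)
    (hpos : 0 < expectedUtility P l X) : expectedUtility P l X / l ≤ ∫ ω, X ω ∂Q := by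
  obtain ⟨y, hy, hyl, hle, hmem⟩ := exists_of_mem_finiteEntropy hQ
  have hQp : IsProbabilityMeasure Q := hQ.1
  have hl : 0 ≤ l := hy.le.trans hyl
  have hXQ : Integrable X Q := (hX.smul_measure ENNReal.ofReal_ne_top).mono_measure hle
  have hZX : Integrable (fun ω => (Q.rnDeriv P ω).toReal * X ω) P :=
    (integrable_toReal_rnDeriv_mul_iff hQ.2.1).2 hXQ
  have h1 := expectedUtility_le_integral_mul (Z := fun ω => y * (Q.rnDeriv P ω).toReal) hl hX
    (by simpa only [mul_assoc] using hZX.const_mul y) hmem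
  simp only [mul_assoc] at h1
  rw [integral_const_mul, integral_toReal_rnDeriv_mul hQ.2.1] at h1
  have h2 : 0 < ∫ ω, X ω ∂Q := pos_of_mul_pos_right (hpos.trans_le h1) hy.le
  rw [div_le_iff₀ (hy.trans_le hyl), mul_comm]
  exact h1.trans (mul_le_mul_of_nonneg_right hyl h2.le)

/-- A function with values in `[1, l]` is, up to normalization, the density of a probability measure
with finite entropy. -/
theorem exists_mem_finiteEntropy_of_density [IsProbabilityMeasure P] {Z : Ω → ℝ}
    (hZ : Measurable Z) (hZl : ∀ ω, 1 ≤ Z ω ∧ Z ω ≤ l) :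
    ∃ Q ∈ finiteEntropy P l, ∃ c : ℝ, 0 < c ∧ Q ≤ ENNReal.ofReal (l / c) • P ∧
      ∀ X : Ω → ℝ, ∫ ω, X ω ∂Q = (∫ ω, Z ω * X ω ∂P) / c := by
  have hZi : Integrable Z P := Integrable.mono' (integrable_const l) hZ.aestronglyMeasurable
    (ae_of_all _ fun ω => by
      rw [Real.norm_eq_abs, abs_of_nonneg (zero_le_one.trans (hZl ω).1)]
      exact (hZl ω).2)
  set c := ∫ ω, Z ω ∂P with hc_def
  have hc1 : 1 ≤ c := by
    have := integral_mono (integrable_const (1 : ℝ)) hZi fun ω => (hZl ω).1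
    simpa using this
  have hc : 0 < c := zero_lt_one.trans_le hc1
  have hZc : ∀ ω, 0 ≤ Z ω / c := fun ω => div_nonneg (zero_le_one.trans (hZl ω).1) hc.le
  have hm : Measurable fun ω => ENNReal.ofReal (Z ω / c) := (hZ.div_const c).ennreal_ofReal
  let Q : Measure Ω := P.withDensity fun ω => ENNReal.ofReal (Z ω / c)
  have hQprob : IsProbabilityMeasure Q := by
    refine ⟨?_⟩
    rw [withDensity_apply _ MeasurableSet.univ, Measure.restrict_univ,
      ← ofReal_integral_eq_lintegral_ofReal (hZi.div_const c) (ae_of_all _ hZc), integral_div,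
      ← hc_def, div_self hc.ne', ENNReal.ofReal_one]
  have hQP : Q ≪ P := withDensity_absolutelyContinuous _ _
  -- The choice `y = c` undoes the normalization: `c dQ/dP = Z` lies in `[1, l]`, where the
  -- conjugate vanishes.
  refine ⟨Q, ⟨hQprob, hQP, c, hc, ?_⟩, c, hc, ?_, fun X => ?_⟩
  · refine lt_of_eq_of_lt (lintegral_congr_ae (g := fun _ => 0) ?_) (by simp)
    filter_upwards [Measure.rnDeriv_withDensity P hm] with ω hω
    rw [hω, ENNReal.toReal_ofReal (hZc ω), mul_div_cancel₀ _ hc.ne',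
      conjugate_eq_zero (hZl ω).1 (hZl ω).2]
    simp
  · rw [← withDensity_const]
    refine withDensity_mono (ae_of_all _ fun ω => ENNReal.ofReal_le_ofReal ?_)
    exact div_le_div_of_nonneg_right (hZl ω).2 hc.le
  · rw [integral_withDensity_eq_integral_toReal_smul hm (ae_of_all _ fun _ => ENNReal.ofReal_lt_top),
      ← integral_div]
    refine integral_congr_ae (ae_of_all _ fun ω => ?_)
    simp only [ENNReal.toReal_ofReal (hZc ω), smul_eq_mul]
    ring

end Density

/-! ### The dual representation of the best gain-loss ratio -/

section Market

variable {Ω : Type*} {m : MeasurableSpace Ω} {T : ℝ≥0} {d : ℕ} {F : Filtration (Time T) m}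
  {S : Time T → Ω → EuclideanSpace ℝ (Fin d)} {P : Measure Ω} {B : Ω → ℝ} {l : ℝ}

theorem ofReal_lt_bestGainLoss_iff (hl : 0 ≤ l) (hK : ∀ K ∈ gains S F, Integrable K P)
    (hB : Integrable B P) : ENNReal.ofReal l < bestGainLoss S F P B ↔
      ∃ K ∈ gains S F, 0 < expectedUtility P l (B + K) := by
  simp only [bestGainLoss, lt_iSup_iff, exists_prop]
  refine exists_congr fun K => and_congr_right fun hKm => ?_
  rw [ofReal_lt_gainLossRatio_iff hl (hB.add (hK K hKm)), and_iff_right_iff_imp]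
  intro hpos h0
  rw [expectedUtility_congr h0] at hpos
  simp [expectedUtility, utility] at hpos

/-- A large multiple of a good gain swamps `B`. Levels `r < 1` also occur here, so only `0 ≤ r` is
available. -/
theorem bestGainLoss_zero_le (hK : ∀ K ∈ gains S F, Integrable K P) (hB : Integrable B P) :
    bestGainLoss S F P 0 ≤ bestGainLoss S F P B := by
  refine ENNReal.le_of_forall_nnreal_lt fun r hr => le_of_lt ?_
  rw [← ENNReal.ofReal_coe_nnreal] at hr ⊢
  rw [ofReal_lt_bestGainLoss_iff r.coe_nonneg hK (integrable_zero _ _ _)] at hr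
  rw [ofReal_lt_bestGainLoss_iff r.coe_nonneg hK hB]
  obtain ⟨K, hKm, hpos⟩ := hr
  rw [zero_add] at hpos
  obtain ⟨t, -, ht⟩ := exists_expectedUtility_add_mul_pos r.coe_nonneg (hK K hKm) hB hpos
  exact ⟨t • K, smul_mem_gains t hKm, ht⟩

theorem one_le_bestGainLoss_zero (hK : ∀ K ∈ gains S F, Integrable K P)
    (hne : ∃ K ∈ gains S F, ¬ K =ᵐ[P] 0) : 1 ≤ bestGainLoss S F P 0 := by
  obtain ⟨K, hKm, hK0⟩ := hne
  have key : ∀ K ∈ gains S F, ¬ K =ᵐ[P] 0 →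
      ∫⁻ ω, ENNReal.ofReal (-K ω) ∂P ≤ ∫⁻ ω, ENNReal.ofReal (K ω) ∂P →
      1 ≤ bestGainLoss S F P 0 := by
    intro K hKm hK0 hle
    refine (one_le_gainLossRatio (hK K hKm) hK0 hle).trans ?_
    refine le_iSup₂_of_le K hKm (le_iSup_of_le (by rwa [zero_add]) ?_)
    rw [zero_add]
  rcases le_total (∫⁻ ω, ENNReal.ofReal (-K ω) ∂P) (∫⁻ ω, ENNReal.ofReal (K ω) ∂P) with h | h
  · exact key K hKm hK0 h
  · refine key ((-1 : ℝ) • K) (smul_mem_gains _ hKm) (fun h0 => hK0 ?_) ?_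
    · filter_upwards [h0] with ω hω
      simpa using hω
    · simpa using h

/-- If `α` is at least the default value, which is at least `1`, then `α` is the supremum of
the reals in `[1, α)`. -/
theorem eq_supWithDefault {a α : ℝ≥0∞} (ha : 1 ≤ a) (haα : a ≤ α) :
    α = supWithDefault a {l : ℝ | 1 ≤ l ∧ ENNReal.ofReal l < α} := by
  rw [supWithDefault]
  split_ifs with h
  · refine le_antisymm (le_trans (not_lt.1 fun h1 => ?_) ha) haα
    have : (1 : ℝ) ∈ {l : ℝ | 1 ≤ l ∧ ENNReal.ofReal l < α} := ⟨le_rfl, by simpa using h1⟩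
    rw [h] at this
    exact this
  · obtain ⟨l₀, hl₀⟩ := Set.nonempty_iff_ne_empty.2 h
    have h1 : 1 < α := lt_of_le_of_lt (by simpa using ENNReal.ofReal_le_ofReal hl₀.1) hl₀.2
    refine le_antisymm (le_of_forall_lt fun c hc => ?_) (iSup₂_le fun l hl => hl.2.le)
    -- Taking the maximum with `1` ensures that `r` belongs to the set.
    obtain ⟨r, hr, hrα⟩ := exists_between (max_lt hc h1)
    have hrt : r ≠ ⊤ := ne_top_of_lt hrα
    have hr' : ENNReal.ofReal r.toReal = r := ENNReal.ofReal_toReal hrt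
    refine lt_of_lt_of_le ((le_max_left _ _).trans_lt hr)
      (le_iSup₂_of_le r.toReal ⟨?_, by rwa [hr']⟩ hr'.ge)
    rw [← ENNReal.toReal_one]
    exact ENNReal.toReal_mono hrt ((le_max_right _ _).trans hr.le)

variable [IsProbabilityMeasure P]

/-- The bounded density gives `Q ≤ (l / y) P`, which carries integrability of the maximal functional
over to `Q`. -/
theorem integral_eq_zero_of_mem_martingaleMeasures (hcad : ∀ᵐ ω ∂P, IsCadlag fun t => S t ω)
    (hint : ∫⁻ ω, maximalFunctional S ω ∂P < ⊤) {Q : Measure Ω}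
    (hQ : Q ∈ finiteEntropy P l ∩ martingaleMeasures S F P) {K : Ω → ℝ} (hK : K ∈ gains S F) :
    ∫ ω, K ω ∂Q = 0 := by
  obtain ⟨y, -, -, hle, -⟩ := exists_of_mem_finiteEntropy hQ.1
  have hQp : IsProbabilityMeasure Q := hQ.1.1
  refine integral_eq_zero_of_mem_gains hQ.2.2.2 (hQ.1.2.1.ae_le hcad) ?_ hK
  refine (lintegral_mono' hle le_rfl).trans_lt ?_
  rw [lintegral_smul_measure]
  exact ENNReal.mul_lt_top ENNReal.ofReal_lt_top hint

theorem le_integral_of_expectedUtility_pos (hS : StronglyAdapted F S)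
    (hcad : ∀ᵐ ω ∂P, IsCadlag fun t => S t ω)
    (hint : ∫⁻ ω, maximalFunctional S ω ∂P < ⊤) (hB : Integrable B P) {K : Ω → ℝ}
    (hK : K ∈ gains S F) (hpos : 0 < expectedUtility P l (B + K)) {Q : Measure Ω}
    (hQ : Q ∈ finiteEntropy P l ∩ martingaleMeasures S F P) :
    expectedUtility P l (B + K) / l ≤ ∫ ω, B ω ∂Q := by
  have hKi := integrable_of_mem_gains hS hcad hint hK
  obtain ⟨y, -, -, hle, -⟩ := exists_of_mem_finiteEntropy hQ.1
  have h1 := expectedUtility_le_of_mem_finiteEntropy hQ.1 (hB.add hKi) hpos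
  simp only [Pi.add_apply] at h1
  rwa [integral_add ((hB.smul_measure ENNReal.ofReal_ne_top).mono_measure hle)
    ((hKi.smul_measure ENNReal.ofReal_ne_top).mono_measure hle),
    integral_eq_zero_of_mem_martingaleMeasures hcad hint hQ hK, add_zero] at h1

theorem exists_expectedUtility_pos (hS : StronglyAdapted F S)
    (hcad : ∀ᵐ ω ∂P, IsCadlag fun t => S t ω)
    (hint : ∫⁻ ω, maximalFunctional S ω ∂P < ⊤) (hB : Integrable B P) (hl : 1 ≤ l)
    (h : ∀ Q ∈ finiteEntropy P l ∩ martingaleMeasures S F P, 0 < ∫ ω, B ω ∂Q) :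
    ∃ K ∈ gains S F, 0 < expectedUtility P l (B + K) := by
  by_contra! hcon
  obtain ⟨Z, hZ, hZl, hZK, hZB⟩ := exists_density_of_expectedUtility_add_nonpos hl
    (gainsSubmodule F S) (fun K hK => integrable_of_mem_gains hS hcad hint hK) hB hcon
  obtain ⟨Q, hQ, c, hc, hle, hQint⟩ := exists_mem_finiteEntropy_of_density (P := P) hZ hZl
  have hQp : IsProbabilityMeasure Q := hQ.1
  have hQM : Martingale S F Q := by
    refine martingale_of_integral_gains_eq_zero hS (hQ.2.1.ae_le hcad) ?_ fun K hK => ?_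
    · refine (lintegral_mono' hle le_rfl).trans_lt ?_
      rw [lintegral_smul_measure]
      exact ENNReal.mul_lt_top ENNReal.ofReal_lt_top hint
    · rw [hQint, hZK K hK, zero_div]
  have := h Q ⟨hQ, hQ.1, hQ.2.1, hQM⟩
  rw [hQint] at this
  exact absurd this (not_lt.2 (div_nonpos_of_nonpos_of_nonneg hZB hc.le))

theorem forall_integral_pos_iff (hS : StronglyAdapted F S)
    (hcad : ∀ᵐ ω ∂P, IsCadlag fun t => S t ω)
    (hint : ∫⁻ ω, maximalFunctional S ω ∂P < ⊤) (hB : Integrable B P) (hl : 1 ≤ l) :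
    (∀ Q ∈ finiteEntropy P l ∩ martingaleMeasures S F P, 0 < ∫ ω, B ω ∂Q) ↔
      ENNReal.ofReal l < bestGainLoss S F P B := by
  rw [ofReal_lt_bestGainLoss_iff (by linarith)
    (fun K hK => integrable_of_mem_gains hS hcad hint hK) hB]
  refine ⟨exists_expectedUtility_pos hS hcad hint hB hl, ?_⟩
  rintro ⟨K, hK, hpos⟩ Q hQ
  exact lt_of_lt_of_le (by positivity)
    (le_integral_of_expectedUtility_pos hS hcad hint hB hK hpos hQ)

theorem marketRisk_neg_iff (hS : StronglyAdapted F S)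
    (hcad : ∀ᵐ ω ∂P, IsCadlag fun t => S t ω)
    (hint : ∫⁻ ω, maximalFunctional S ω ∂P < ⊤) (hB : Integrable B P) (hl : 1 ≤ l) :
    marketRisk S F P l B < 0 ↔ ENNReal.ofReal l < bestGainLoss S F P B := by
  rw [← forall_integral_pos_iff hS hcad hint hB hl]
  constructor
  · intro h Q hQ
    have h1 : ((∫ ω, -B ω ∂Q : ℝ) : EReal) < 0 := lt_of_le_of_lt
      (le_iSup₂ (f := fun (Q : Measure Ω) (_ : Q ∈ finiteEntropy P l ∩ martingaleMeasures S F P) =>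
        ((∫ ω, -B ω ∂Q : ℝ) : EReal)) Q hQ) h
    rw [integral_neg] at h1
    have h2 : -∫ ω, B ω ∂Q < 0 := by exact_mod_cast h1
    linarith
  · intro h
    obtain ⟨K, hK, hpos⟩ := exists_expectedUtility_pos hS hcad hint hB hl h
    have hc : 0 < expectedUtility P l (B + K) / l := by positivity
    refine lt_of_le_of_lt (b := ((-(expectedUtility P l (B + K) / l) : ℝ) : EReal))
      (iSup₂_le fun Q hQ => ?_) (by exact_mod_cast neg_neg_of_pos hc)
    rw [integral_neg, EReal.coe_le_coe_iff]
    exact neg_le_neg (le_integral_of_expectedUtility_pos hS hcad hint hB hK hpos hQ)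

end Market

end GainLoss

/-! ### The main theorem -/

theorem mainTheorem5 {Ω : Type*} {m : MeasurableSpace Ω} (P : Measure Ω) [IsProbabilityMeasure P]
    (T : ℝ≥0) (d : ℕ) (F : Filtration (GainLoss.Time T) m)
    (S : GainLoss.Time T → Ω → EuclideanSpace ℝ (Fin d))
    (hF : GainLoss.UsualAssumptions F P)
    (hS : GainLoss.IsSemimartingale S F P)
    (hS_int : ∫⁻ ω, GainLoss.maximalFunctional S ω ∂P < ⊤)
    (hK : ∃ K ∈ GainLoss.gains S F, ¬ (K =ᵐ[P] 0))
    (B : Ω → ℝ) (hB : Integrable B P) :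
    GainLoss.bestGainLoss S F P B =
        GainLoss.supWithDefault (GainLoss.bestGainLoss S F P 0)
          {l : ℝ | 1 ≤ l ∧
            ∀ Q ∈ GainLoss.finiteEntropy P l ∩ GainLoss.martingaleMeasures S F P,
              0 < ∫ ω, B ω ∂Q} ∧
      GainLoss.bestGainLoss S F P B =
        GainLoss.supWithDefault (GainLoss.bestGainLoss S F P 0)
          {l : ℝ | 1 ≤ l ∧ GainLoss.marketRisk S F P l B < 0} := by
  have hK_int : ∀ K ∈ GainLoss.gains S F, Integrable K P := fun K hKm =>
    GainLoss.integrable_of_mem_gains hS.adapted hS.cadlag hS_int hKm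
  have key := GainLoss.eq_supWithDefault (GainLoss.one_le_bestGainLoss_zero hK_int hK)
    (GainLoss.bestGainLoss_zero_le hK_int hB)
  constructor
  · refine key.trans (congrArg _ (Set.ext fun l => and_congr_right fun hl => ?_))
    exact (GainLoss.forall_integral_pos_iff hS.adapted hS.cadlag hS_int hB hl).symm
  · refine key.trans (congrArg _ (Set.ext fun l => and_congr_right fun hl => ?_))
    exact (GainLoss.marketRisk_neg_iff hS.adapted hS.cadlag hS_int hB hl).symm
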